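/- Let $T>0$, $d,m\in\mathbb N$, let $H\in(\tfrac12,1)$, and let $W^H=(W^{H,1},\dots,W^{H,m})$ be independent fractional Brownian motions with Hurst parameter $H$ on a probability space $(\Omega,\mathcal F,P)$, that is, independent centered Gaussian processes indexed by $t\ge 0$ with covariance $\tfrac12(s^{2H}+t^{2H}-|t-s|^{2H})$ and almost surely continuous paths. Let $x(0)\in\mathbb R^d$ with $x^i(0)>0$ for $i=1,\dots,d$. Assume: (H1) $\sigma:[0,T]\times\mathbb R^d\to\mathbb R^{d\times m}$ is bounded and there are constants $K_0$ and $\nu\ge H$ such that $|\sigma(t,x)-\sigma(t,y)|\le K_0|x-y|$ and $|\sigma(t,x)-\sigma(s,x)|\le K_0|t-s|^{\nu}$ for all $x,y\in\mathbb R^d$ and $s,t\in[0,T]$; (H2) $b:[0,T]\times\mathbb R^d\to\mathbb R^d$ is bounded, measurable in $t$, and there is a constant $K_0$ such that $|b(t,x)-b(t,y)|\le K_0|x-y|$ for all $x,y\in\mathbb R^d$ and $t\in[0,T]$. Let $\lambda_0\in(\tfrac12,H)$, and let $C^{\lambda_0}(0,T;\mathbb R^d)$ be the space of $\lambda_0$-Hölder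 continuous functions $[0,T]\to\mathbb R^d$ with the norm $\|f\|_\infty+\sup_{0\le u<v\le T}\frac{|f(v)-f(u)|}{(v-u)^{\lambda_0}}$. Then there is $X\in L^0(\Omega,\mathcal F,P;C^{\lambda_0}(0,T;\mathbb R^d))$ (the space of almost-everywhere classes of strongly measurable maps) such that, almost surely, for all $t\in[0,T]$, $$X(t)=Z(t)+Y(t),\qquad Z(t)=x(0)+\int_0^t b(s,X(s))\,ds+\int_0^t\sigma(s,X(s))\,dW^H_s,$$ $$Y^i(t)=\max_{s\in[0,t]}\bigl(Z^i(s)\bigr)^-,\qquad i=1,\dots,d,$$ and $(X,Y)$ solves the Skorokhod problem for $Z$ on $[0,T]$: $X,Y,Z$ are continuous, $X^i\ge0$, $Y^i(0)=0$, $Y^i$ is non-decreasing and $\int_0^t X^i\,dY^i=0$ for all $t\in[0,T]$ and all $i$. Here $\int\sigma(s,X(s))\,dW^H_s$ is the pathwise Young integral: if $f$ is $\kappa$-Hölder and $g$ is $\gamma$-Hölder on $[0,T]$ with $\kappa+\gamma>1$, then $\int_s^t f\,dg=f_s(g_t-g_s)+R_{st}$, where $R$ is the unique continuous function on $[0,T]^2$,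 zero on the diagonal, with $|R_{st}|\le C|t-s|^{\mu}$ for some $C$ and some $\mu>1$ and $R_{st}-R_{su}-R_{ut}=(f_u-f_s)(g_t-g_u)$ for all $s,u,t\in[0,T]$. -/

import Mathlib

open MeasureTheory ProbabilityTheory Set
open scoped NNReal ENNReal

/-! ### The Hölder space `C^r(0,T;E)` -/

section HolderSpace

variable (r : ℝ≥0) (T : ℝ) (E : Type*) [NormedAddCommGroup E]

/-- The additive group of continuous functions `[0,T] → E` with finite `r`-Hölder seminorm. -/
def holderAddSubgroup : AddSubgroup C(Icc (0 : ℝ) T, E) where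
  carrier := {f | MemHolder r f}
  zero_mem' := memHolder_zero
  add_mem' := fun hf hg => hf.add hg
  neg_mem' := fun {f} hf => by
    obtain ⟨C, hC⟩ := hf
    refine ⟨C, fun s t => ?_⟩
    have h := hC s t
    simpa [edist_neg_neg] using h

/-- The space `C^r(0,T;E)` of `r`-Hölder continuous functions on `[0,T]`. -/
def HolderSpace : Type _ := holderAddSubgroup r T E

namespace HolderSpace

variable {r T E}

noncomputable instance : AddCommGroup (HolderSpace r T E) :=
  inferInstanceAs (AddCommGroup (holderAddSubgroup r T E))

instance : CoeFun (HolderSpace r T E) (fun _ => Icc (0 : ℝ) T → E) := ⟨fun f => f.1⟩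

/-- The Hölder norm `‖f‖_∞ + sup_{u < v} |f v - f u| / (v - u)^r`. -/
noncomputable def holderGroupNorm : AddGroupNorm (HolderSpace r T E) where
  toFun f := ‖f.1‖ + (nnHolderNorm r (f : Icc (0 : ℝ) T → E) : ℝ)
  map_zero' := by
    have h : ((0 : HolderSpace r T E) : Icc (0 : ℝ) T → E) = 0 := rfl
    have h1 : (0 : HolderSpace r T E).1 = 0 := rfl
    rw [h, h1]
    simp
  add_le' f g := by
    have h1 : ‖(f + g).1‖ ≤ ‖f.1‖ + ‖g.1‖ := norm_add_le f.1 g.1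
    have h2 : nnHolderNorm r ((f + g : HolderSpace r T E) : Icc (0 : ℝ) T → E)
        ≤ nnHolderNorm r (f : Icc (0 : ℝ) T → E) + nnHolderNorm r (g : Icc (0 : ℝ) T → E) :=
      MemHolder.nnHolderNorm_add_le f.2 g.2
    have h3 : (nnHolderNorm r ((f + g : HolderSpace r T E) : Icc (0 : ℝ) T → E) : ℝ)
        ≤ nnHolderNorm r (f : Icc (0 : ℝ) T → E) + nnHolderNorm r (g : Icc (0 : ℝ) T → E) :=
      mod_cast h2
    linarith
  neg' f := by
    have h1 : ‖(-f).1‖ = ‖f.1‖ := norm_neg f.1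
    have h2 : ∀ g : HolderSpace r T E, nnHolderNorm r ((-g : HolderSpace r T E) :
        Icc (0 : ℝ) T → E) ≤ nnHolderNorm r (g : Icc (0 : ℝ) T → E) := fun g => by
      refine HolderWith.nnholderNorm_le fun s t => ?_
      have h := (MemHolder.holderWith g.2) s t
      have e : edist ((-g : HolderSpace r T E) s) ((-g : HolderSpace r T E) t)
          = edist (g s) (g t) := edist_neg_neg _ _
      rw [e]
      exact h
    have h3 := h2 (-f)
    rw [neg_neg] at h3
    rw [h1, le_antisymm (h2 f) h3]
  eq_zero_of_map_eq_zero' f hf := by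
    have hf' : ‖f.1‖ + (nnHolderNorm r (f : Icc (0 : ℝ) T → E) : ℝ) = 0 := hf
    have h1 : (0 : ℝ) ≤ nnHolderNorm r (f : Icc (0 : ℝ) T → E) := NNReal.coe_nonneg _
    have h0 : ‖f.1‖ = 0 := le_antisymm (by linarith) (norm_nonneg _)
    exact Subtype.ext (norm_eq_zero.1 h0)

noncomputable instance : NormedAddCommGroup (HolderSpace r T E) :=
  holderGroupNorm.toNormedAddCommGroup

end HolderSpace

end HolderSpace

/-! ### Fractional Brownian motion -/

/-- A fractional Brownian motion with Hurst parameter `H`: a centered Gaussian process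
`(B_t)_{t ≥ 0}` with covariance `(s^{2H} + t^{2H} - |t - s|^{2H}) / 2` and almost surely
continuous paths. -/
structure IsFractionalBrownianMotion {Ω : Type*} [MeasurableSpace Ω]
    (H : ℝ) (B : ℝ≥0 → Ω → ℝ) (P : Measure Ω) : Prop where
  gaussian : IsGaussianProcess B P
  centered : ∀ t, ∫ ω, B t ω ∂P = 0
  covariance_eq : ∀ s t : ℝ≥0, cov[B s, B t; P] =
    ((s : ℝ) ^ (2 * H) + (t : ℝ) ^ (2 * H) - |(t : ℝ) - s| ^ (2 * H)) / 2
  continuous_paths : ∀ᵐ ω ∂P, Continuous fun t => B t ω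

/-- The path `t ↦ (W^1_t(ω), …, W^m_t(ω))`, as a function of a real time `t`; only times
`t ≥ 0` matter. -/
noncomputable def drivingPath {Ω : Type*} {m : ℕ} (W : Fin m → ℝ≥0 → Ω → ℝ) (ω : Ω) (t : ℝ) :
    EuclideanSpace ℝ (Fin m) :=
  WithLp.toLp 2 fun j => W j t.toNNReal ω

/-! ### The Young integral (algebraic integration) and the coefficients -/

/-- `R = Λ h` on `[0,T]`: `R` is a continuous increment vanishing on the diagonal, with
`|R_{st}| ≤ C |t - s|^μ` for some `μ > 1`, and `(δR)_{sut} = R_{st} - R_{su} - R_{ut} = h_{sut}`.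
There is at most one such `R` on `[0,T]²`. -/
structure IsSewing {V : Type*} [NormedAddCommGroup V] (T : ℝ) (h : ℝ → ℝ → ℝ → V)
    (R : ℝ → ℝ → V) : Prop where
  continuousOn : ContinuousOn (fun p : ℝ × ℝ => R p.1 p.2) (Icc 0 T ×ˢ Icc 0 T)
  diag : ∀ t ∈ Icc 0 T, R t t = 0
  bound : ∃ C μ : ℝ, 1 < μ ∧ ∀ s ∈ Icc 0 T, ∀ t ∈ Icc 0 T, ‖R s t‖ ≤ C * |t - s| ^ μ
  delta_eq : ∀ s ∈ Icc 0 T, ∀ u ∈ Icc 0 T, ∀ t ∈ Icc 0 T, R s t - R s u - R u t = h s u t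

section Coefficients

open scoped Matrix.Norms.Frobenius

/-- `J s t = ∫_s^t f dg` for `s, t ∈ [0,T]` in the Young sense: `f` is `κ`-Hölder and `g` is
`γ`-Hölder on `[0,T]` with `κ + γ > 1`, and `∫_s^t f dg = f_s (δg)_{st} + Λ_{st}(δf δg)`. -/
def IsYoungIntegral {d m : ℕ} (T : ℝ) (f : ℝ → Matrix (Fin d) (Fin m) ℝ)
    (g : ℝ → EuclideanSpace ℝ (Fin m)) (J : ℝ → ℝ → EuclideanSpace ℝ (Fin d)) : Prop :=
  (∃ κ γ C D : ℝ≥0, 0 < κ ∧ 0 < γ ∧ 1 < κ + γ ∧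
    HolderOnWith C κ f (Icc 0 T) ∧ HolderOnWith D γ g (Icc 0 T)) ∧
  ∃ R : ℝ → ℝ → EuclideanSpace ℝ (Fin d),
    IsSewing T (fun s u t => Matrix.toEuclideanLin (f u - f s) (g t - g u)) R ∧
    ∀ s ∈ Icc 0 T, ∀ t ∈ Icc 0 T, J s t = Matrix.toEuclideanLin (f s) (g t - g s) + R s t

/-- Hypothesis (H1) on the diffusion coefficient, with time-Hölder exponent `ν`. -/
structure DiffusionHypothesis {d m : ℕ} (T ν : ℝ)
    (σ : ℝ → EuclideanSpace ℝ (Fin d) → Matrix (Fin d) (Fin m) ℝ) : Prop where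
  bounded : ∃ M : ℝ, ∀ t ∈ Icc 0 T, ∀ x, ‖σ t x‖ ≤ M
  regular : ∃ K₀ : ℝ,
    (∀ t ∈ Icc 0 T, ∀ x y, ‖σ t x - σ t y‖ ≤ K₀ * ‖x - y‖) ∧
    (∀ x, ∀ t ∈ Icc 0 T, ∀ s ∈ Icc 0 T, ‖σ t x - σ s x‖ ≤ K₀ * |t - s| ^ ν)

end Coefficients

/-- Hypothesis (H2) on the drift coefficient (with the measurability in time which the
Lebesgue integral of the drift presupposes). -/
structure DriftHypothesis {d : ℕ} (T : ℝ)
    (b : ℝ → EuclideanSpace ℝ (Fin d) → EuclideanSpace ℝ (Fin d)) : Prop where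
  measurable : ∀ x, AEStronglyMeasurable (fun t => b t x) (volume.restrict (Icc 0 T))
  bounded : ∃ M : ℝ, ∀ t ∈ Icc 0 T, ∀ x, ‖b t x‖ ≤ M
  lipschitz : ∃ K₀ : ℝ, ∀ t ∈ Icc 0 T, ∀ x y, ‖b t x - b t y‖ ≤ K₀ * ‖x - y‖

/-! ### The Skorokhod problem and the reflected equation -/

/-- `(x, y)` solves the Skorokhod problem for `z` on `[0,T]`, with reflection at the boundary of
the non-negative orthant. In `complementary` the integral `∫_0^t x^i dy^i` (of the non-negative
function `x^i`) is the Lebesgue–Stieltjes one. -/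
structure IsSkorokhodSolution {d : ℕ} (T : ℝ) (z x y : ℝ → EuclideanSpace ℝ (Fin d)) : Prop where
  continuousOn_z : ContinuousOn z (Icc 0 T)
  continuousOn_x : ContinuousOn x (Icc 0 T)
  continuousOn_y : ContinuousOn y (Icc 0 T)
  start_nonneg : ∀ i, 0 ≤ z 0 i
  eq_add : ∀ t ∈ Icc 0 T, x t = z t + y t
  nonneg : ∀ t ∈ Icc 0 T, ∀ i, 0 ≤ x t i
  regulator_zero : ∀ i, y 0 i = 0
  regulator_mono : ∀ i, MonotoneOn (fun t => y t i) (Icc 0 T)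
  complementary : ∀ i, ∃ F : StieltjesFunction ℝ, (∀ t ∈ Icc 0 T, F t = y t i) ∧
    ∀ t ∈ Icc 0 T, ∫⁻ s in Ioc 0 t, ENNReal.ofReal (x s i) ∂F.measure = 0

/-- `x` solves the reflected equation
`x(t) = x₀ + ∫_0^t b(s,x(s)) ds + ∫_0^t σ(s,x(s)) dg_s + y(t)` on `[0,T]`, where `y` is the
regulator of `z(t) = x₀ + ∫_0^t b(s,x(s)) ds + ∫_0^t σ(s,x(s)) dg_s`, that is,
`y^i(t) = max_{s ∈ [0,t]} (z^i(s))^-`. -/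
def IsReflectedSolution {d m : ℕ} (T : ℝ)
    (b : ℝ → EuclideanSpace ℝ (Fin d) → EuclideanSpace ℝ (Fin d))
    (σ : ℝ → EuclideanSpace ℝ (Fin d) → Matrix (Fin d) (Fin m) ℝ)
    (x₀ : EuclideanSpace ℝ (Fin d)) (g : ℝ → EuclideanSpace ℝ (Fin m))
    (x : ℝ → EuclideanSpace ℝ (Fin d)) : Prop :=
  IntervalIntegrable (fun s => b s (x s)) volume 0 T ∧
  ∃ (J : ℝ → ℝ → EuclideanSpace ℝ (Fin d)) (z y : ℝ → EuclideanSpace ℝ (Fin d)),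
    IsYoungIntegral T (fun s => σ s (x s)) g J ∧
    (∀ t ∈ Icc 0 T, z t = x₀ + (∫ s in (0 : ℝ)..t, b s (x s)) + J 0 t) ∧
    (∀ t ∈ Icc 0 T, ∀ i, IsGreatest ((fun s => (z s i)⁻) '' Icc 0 t) (y t i)) ∧
    IsSkorokhodSolution T z x y

/-! Fractional Brownian paths are `γ`-Hölder for every `γ < H`, so for `lam₀ < γ < H` the equation
is a pathwise problem with a Hölder driver of exponent `γ > 1 / 2`. In the Euler scheme the
Skorokhod regulator on a time interval oscillates at most as much as the unreflected path does
there, so reflection preserves Hölder regularity. Discrete sewing then bounds the `γ`-Hölder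
constants of the scheme on short intervals, and hence on `[0, T]`, uniformly in the mesh. By
Arzelà–Ascoli the unreflected Euler paths stay in a compact set. The Young remainder estimate and
continuity of the Skorokhod map show that each of their cluster points gives a solution. Since
solutions are not known to be unique, a cluster point has to be selected measurably in `ω`. -/

section DiscreteYoung

section Sewing

variable {V : Type*} [NormedAddCommGroup V] {θ : ℝ}

/-- The sequence `z`, read as the values of a path at the points of a grid of mesh `h`, is
`γ`-Hölder with constant `C` on the index range `[a, b]`. The real constant `C` is not required to
be nonnegative. -/
def GridHolderOn (C γ h : ℝ) (z : ℕ → V) (a b : ℕ) : Prop :=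
  ∀ ⦃i j : ℕ⦄, a ≤ i → i ≤ j → j ≤ b → ‖z j - z i‖ ≤ C * (h * (j - i)) ^ γ

/-- The constant of the sewing estimate `norm_sub_sum_Ico_le` with exponent `θ > 1`. -/
noncomputable def sewingConst (θ : ℝ) : ℝ := (1 - (2 / 3 : ℝ) ^ (θ - 1))⁻¹

lemma GridHolderOn.mono {C γ h : ℝ} {z : ℕ → V} {a b a' b' : ℕ} (hz : GridHolderOn C γ h z a b)
    (ha : a ≤ a') (hb : b' ≤ b) : GridHolderOn C γ h z a' b' :=
  fun _ _ hi hij hj => hz (ha.trans hi) hij (hj.trans hb)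

lemma two_thirds_rpow_lt_one (hθ : 1 < θ) : (2 / 3 : ℝ) ^ (θ - 1) < 1 :=
  Real.rpow_lt_one (by norm_num) (by norm_num) (by linarith)

lemma sewingConst_pos (hθ : 1 < θ) : 0 < sewingConst θ :=
  inv_pos.2 (sub_pos.2 (two_thirds_rpow_lt_one hθ))

lemma sewingConst_mul_add_one (hθ : 1 < θ) :
    sewingConst θ * (2 / 3 : ℝ) ^ (θ - 1) + 1 = sewingConst θ := by
  have := sub_pos.2 (two_thirds_rpow_lt_one hθ)
  rw [sewingConst]
  field_simp
  ring

lemma rpow_add_rpow_le_two_thirds_rpow_mul {p q : ℝ} (hp : 0 ≤ p) (hq : 0 ≤ q) (hθ : 1 < θ)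
    (hpq : p ≤ 2 / 3 * (p + q)) (hqp : q ≤ 2 / 3 * (p + q)) :
    p ^ θ + q ^ θ ≤ (2 / 3 : ℝ) ^ (θ - 1) * (p + q) ^ θ := by
  have rpow_eq : ∀ r : ℝ, 0 ≤ r → r ^ θ = r ^ (θ - 1) * r := fun r hr => by
    nth_rw 3 [← Real.rpow_one r]
    rw [← Real.rpow_add' hr (by linarith), sub_add_cancel]
  calc p ^ θ + q ^ θ
      ≤ (2 / 3 * (p + q)) ^ (θ - 1) * p + (2 / 3 * (p + q)) ^ (θ - 1) * q := by
        rw [rpow_eq p hp, rpow_eq q hq]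
        gcongr
    _ = (2 / 3 : ℝ) ^ (θ - 1) * (p + q) ^ θ := by
        rw [rpow_eq (p + q) (by positivity), Real.mul_rpow (by norm_num) (by positivity)]
        ring

lemma rpow_add_rpow_le_of_nat_midpoint {h : ℝ} (hθ : 1 < θ) (hh : 0 ≤ h) {a b c : ℕ}
    (hab : a + 1 < b) (hc : c = a + (b - a) / 2) :
    (h * (c - a)) ^ θ + (h * (b - c)) ^ θ ≤ (2 / 3 : ℝ) ^ (θ - 1) * (h * (b - a)) ^ θ := by
  have hac : (a : ℝ) ≤ c := by norm_cast; omega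
  have hcb : (c : ℝ) ≤ b := by norm_cast; omega
  have hac3 : 3 * (c : ℝ) + a ≤ 2 * b + 2 * a := by norm_cast; omega
  have hcb3 : b + 2 * (a : ℝ) ≤ 3 * c := by norm_cast; omega
  have := rpow_add_rpow_le_two_thirds_rpow_mul (p := h * (c - a)) (q := h * (b - c))
    (mul_nonneg hh (by linarith)) (mul_nonneg hh (by linarith)) hθ (by nlinarith) (by nlinarith)
  rwa [← mul_add, sub_add_sub_cancel'] at this

/-- An interval of at least two steps splits at its midpoint into pieces of at most two thirds of
its length, so the defects of a dyadic refinement sum up to a geometric series. -/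
theorem norm_sub_sum_Ico_le {Ξ : ℕ → ℕ → V} {D h : ℝ} (hθ : 1 < θ) (hh : 0 ≤ h) (hD : 0 ≤ D)
    {a b : ℕ} (hab : a < b)
    (hΞ : ∀ i j k : ℕ, a ≤ i → i < j → j < k → k ≤ b →
      ‖Ξ i k - Ξ i j - Ξ j k‖ ≤ D * (h * (k - i)) ^ θ) :
    ‖Ξ a b - ∑ i ∈ Finset.Ico a b, Ξ i (i + 1)‖ ≤ sewingConst θ * D * (h * (b - a)) ^ θ := by
  induction hn : b - a using Nat.strong_induction_on generalizing a b with
  | _ n ih =>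
  have sewing_pos := sewingConst_pos hθ
  have hab' : (a : ℝ) < b := by exact_mod_cast hab
  obtain rfl | hstep : b = a + 1 ∨ a + 1 < b := by omega
  · simp only [Nat.Ico_succ_singleton, Finset.sum_singleton, sub_self, norm_zero]
    have := sub_pos.2 hab'
    positivity
  set c := a + (b - a) / 2 with hc
  have hac : a < c := by omega
  have hcb : c < b := by omega
  have left := ih (c - a) (by omega) hac
    (fun i j k hi hij hjk hk => hΞ i j k hi hij hjk (hk.trans hcb.le)) rfl
  have right := ih (b - c) (by omega) hcb
    (fun i j k hi hij hjk hk => hΞ i j k (hac.le.trans hi) hij hjk hk) rfl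
  calc ‖Ξ a b - ∑ i ∈ Finset.Ico a b, Ξ i (i + 1)‖
      = ‖(Ξ a c - ∑ i ∈ Finset.Ico a c, Ξ i (i + 1))
          + (Ξ c b - ∑ i ∈ Finset.Ico c b, Ξ i (i + 1)) + (Ξ a b - Ξ a c - Ξ c b)‖ := by
        rw [← Finset.sum_Ico_consecutive _ hac.le hcb.le]
        congr 1
        abel
    _ ≤ sewingConst θ * D * (h * (c - a)) ^ θ + sewingConst θ * D * (h * (b - c)) ^ θ
          + D * (h * (b - a)) ^ θ :=
        norm_add₃_le.trans (add_le_add_three left right (hΞ a c b le_rfl hac hcb le_rfl))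
    _ ≤ sewingConst θ * D * ((2 / 3 : ℝ) ^ (θ - 1) * (h * (b - a)) ^ θ)
          + D * (h * (b - a)) ^ θ := by
        rw [← mul_add]
        gcongr
        exact rpow_add_rpow_le_of_nat_midpoint hθ hh hstep hc
    _ = (sewingConst θ * (2 / 3 : ℝ) ^ (θ - 1) + 1) * D * (h * (b - a)) ^ θ := by ring
    _ = sewingConst θ * D * (h * (b - a)) ^ θ := by rw [sewingConst_mul_add_one hθ]

end Sewing

section LocalToGlobal

variable {V : Type*} [NormedAddCommGroup V] {z : ℕ → V} {N : ℕ} {h ε D : ℝ}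

lemma exists_nat_mul_mem_Icc_half (hh : 0 < h) (hε : h ≤ ε) :
    ∃ q : ℕ, h * q ∈ Icc (ε / 2) ε := by
  have one_le : 1 ≤ ⌊ε / h⌋₊ := by rwa [Nat.one_le_floor_iff, one_le_div hh]
  have floor_le := Nat.floor_le (div_nonneg (hh.le.trans hε) hh.le)
  have lt_floor := Nat.lt_floor_add_one (ε / h)
  have one_le' : (1 : ℝ) ≤ ⌊ε / h⌋₊ := by exact_mod_cast one_le
  rw [le_div_iff₀ hh] at floor_le
  rw [div_lt_iff₀ hh] at lt_floor
  exact ⟨⌊ε / h⌋₊, by nlinarith, by linarith⟩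

lemma norm_sub_le_of_forall_short (hh : 0 < h) (hε : h ≤ ε)
    (hz : ∀ i j : ℕ, i ≤ j → j ≤ N → h * (j - i) ≤ ε → ‖z j - z i‖ ≤ D) {k l : ℕ} (hkl : k ≤ l)
    (hl : l ≤ N) : ‖z l - z k‖ ≤ (2 / ε * (h * (l - k)) + 1) * D := by
  obtain ⟨q, hq_ge, hq_le⟩ := exists_nat_mul_mem_Icc_half hh hε
  have hε0 : 0 < ε := hh.trans_le hε
  have hD : 0 ≤ D := by simpa using hz 0 0 le_rfl (Nat.zero_le _) (by simpa using hε0.le)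
  induction hn : l - k using Nat.strong_induction_on generalizing k with
  | _ n ih =>
  have hkl' : (k : ℝ) ≤ l := by exact_mod_cast hkl
  by_cases hshort : h * (l - k) ≤ ε
  · have : 0 ≤ 2 / ε * (h * ((l : ℝ) - k)) :=
      mul_nonneg (by positivity) (mul_nonneg hh.le (by linarith))
    nlinarith [hz k l hkl hl hshort]
  have q_pos : 0 < q := by
    rw [← Nat.cast_pos (α := ℝ)]
    nlinarith
  have hq : k + q ≤ l := by
    have : (k : ℝ) + q ≤ l := by nlinarith
    exact_mod_cast this
  have first := hz k (k + q) (by omega) (hq.trans hl) (by push_cast; linarith)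
  have rest := ih (l - (k + q)) (by omega) hq rfl
  have hq1 : 1 ≤ 2 / ε * (h * q) := by
    rw [div_mul_eq_mul_div, one_le_div hε0]
    linarith
  calc ‖z l - z k‖ ≤ ‖z l - z (k + q)‖ + ‖z (k + q) - z k‖ :=
        norm_sub_le_norm_sub_add_norm_sub _ _ _
    _ ≤ (2 / ε * (h * (l - (k + q : ℕ))) + 1) * D + D := add_le_add rest first
    _ = (2 / ε * (h * (l - k)) + 1) * D + (1 - 2 / ε * (h * q)) * D := by
        push_cast
        ring
    _ ≤ (2 / ε * (h * (l - k)) + 1) * D := by nlinarith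

lemma gridHolderOn_of_forall_short {B T γ : ℝ} (hγ : 0 ≤ γ) (hB : 0 ≤ B) (hT : h * N ≤ T)
    (hh : 0 < h) (hε : h ≤ ε)
    (hz : ∀ i j : ℕ, i ≤ j → j ≤ N → h * (j - i) ≤ ε → ‖z j - z i‖ ≤ B * (h * (j - i)) ^ γ) :
    GridHolderOn ((2 / ε * T + 1) * B) γ h z 0 N := by
  intro k l _ hkl hl
  have hε0 : 0 < ε := hh.trans_le hε
  have length_nonneg : ∀ {i j : ℕ}, i ≤ j → 0 ≤ h * ((j : ℝ) - i) := fun hij =>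
    mul_nonneg hh.le (sub_nonneg.2 (by exact_mod_cast hij))
  have hT' : h * ((l : ℝ) - k) ≤ T := by
    have : (l : ℝ) ≤ N := by exact_mod_cast hl
    nlinarith [(k.cast_nonneg : (0 : ℝ) ≤ k)]
  have hT0 : 0 ≤ T := (length_nonneg hkl).trans hT'
  by_cases hshort : h * (l - k) ≤ ε
  · refine (hz k l hkl hl hshort).trans ?_
    have := Real.rpow_nonneg (length_nonneg hkl) γ
    gcongr
    exact le_mul_of_one_le_left hB (le_add_of_nonneg_left (by positivity))
  have hz' : ∀ i j : ℕ, i ≤ j → j ≤ N → h * (j - i) ≤ ε → ‖z j - z i‖ ≤ B * ε ^ γ :=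
    fun i j hij hj hji => (hz i j hij hj hji).trans
      (by have := length_nonneg hij; gcongr)
  calc ‖z l - z k‖ ≤ (2 / ε * (h * (l - k)) + 1) * (B * ε ^ γ) :=
        norm_sub_le_of_forall_short hh hε hz' hkl hl
    _ ≤ (2 / ε * T + 1) * (B * (h * (l - k)) ^ γ) := by
        have := length_nonneg hkl
        push Not at hshort
        gcongr
    _ = (2 / ε * T + 1) * B * (h * (l - k)) ^ γ := by ring

end LocalToGlobal

variable {U V : Type*} [NormedAddCommGroup U] [NormedSpace ℝ U]
  [NormedAddCommGroup V] [NormedSpace ℝ V]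

lemma norm_riemannSum_sub_le {f : ℕ → U →L[ℝ] V} {w : ℕ → U} {F G h α β : ℝ} (hα : 0 ≤ α)
    (hβ : 0 ≤ β) (hαβ : 1 < α + β) (hh : 0 ≤ h) (hF : 0 ≤ F) (hG : 0 ≤ G) {a b : ℕ}
    (hab : a ≤ b) (hf : GridHolderOn F α h f a b) (hw : GridHolderOn G β h w a (b + 1)) :
    ‖f a (w (b + 1) - w a) - ∑ i ∈ Finset.Ico a (b + 1), f i (w (i + 1) - w i)‖
      ≤ sewingConst (α + β) * (F * G) * (h * (b + 1 - a)) ^ (α + β) := by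
  have := norm_sub_sum_Ico_le (Ξ := fun i j => f i (w j - w i)) (D := F * G) hαβ hh
    (by positivity) (Nat.lt_succ_of_le hab) fun i j k hi hij hjk hk => by
      have hij' : (i : ℝ) < j := by exact_mod_cast hij
      have hjk' : (j : ℝ) < k := by exact_mod_cast hjk
      have hhki : 0 ≤ h * ((k : ℝ) - i) := mul_nonneg hh (by linarith)
      have : 0 ≤ h * ((j : ℝ) - i) := mul_nonneg hh (by linarith)
      have : 0 ≤ h * ((k : ℝ) - j) := mul_nonneg hh (by linarith)
      calc ‖f i (w k - w i) - f i (w j - w i) - f j (w k - w j)‖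
          = ‖(f j - f i) (w k - w j)‖ := by
            rw [← norm_neg]
            simp only [map_sub, sub_apply]
            congr 1
            abel
        _ ≤ ‖f j - f i‖ * ‖w k - w j‖ := ContinuousLinearMap.le_opNorm _ _
        _ ≤ (F * (h * (j - i)) ^ α) * (G * (h * (k - j)) ^ β) := by
            gcongr
            · exact hf hi hij.le (by omega)
            · exact hw (by omega) hjk.le hk
        _ ≤ (F * (h * (k - i)) ^ α) * (G * (h * (k - i)) ^ β) := by gcongr
        _ = F * G * (h * (k - i)) ^ (α + β) := by
            rw [Real.rpow_add_of_nonneg hhki hα hβ]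
            ring
  simpa using this

/-- A solution `z` of the discrete equation `z (k + 1) = z k + β k + f k (w (k + 1) - w k)`,
`k < N`, on a grid of mesh `h`. The coefficient `f` may depend on the past of `z`, but its
oscillation is controlled by that of `z`; `w` is the driver and `β` the drift. -/
structure IsGridSolution (M K G γ h : ℝ) (N : ℕ) (z : ℕ → V) (f : ℕ → U →L[ℝ] V) (w : ℕ → U)
    (β : ℕ → V) : Prop where
  step : ∀ k < N, z (k + 1) = z k + β k + f k (w (k + 1) - w k)
  drift_le : ∀ k < N, ‖β k‖ ≤ M * h
  coeff_le : ∀ k < N, ‖f k‖ ≤ M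
  coeff_sub_le : ∀ k l : ℕ, k ≤ l → l < N → ∀ B : ℝ, (∀ j, k ≤ j → j ≤ l → ‖z j - z k‖ ≤ B) →
    ‖f l - f k‖ ≤ K * ((h * (l - k)) ^ γ + B)
  driver : GridHolderOn G γ h w 0 N

namespace IsGridSolution

variable {M K G γ h : ℝ} {N : ℕ} {z : ℕ → V} {f : ℕ → U →L[ℝ] V} {w : ℕ → U} {β : ℕ → V}

lemma sub_eq (hz : IsGridSolution M K G γ h N z f w β) {k l : ℕ} (hkl : k ≤ l) (hl : l ≤ N) :
    z l - z k = ∑ j ∈ Finset.Ico k l, β j + ∑ j ∈ Finset.Ico k l, f j (w (j + 1) - w j) := by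
  rw [← Finset.sum_add_distrib, ← Finset.sum_Ico_sub z hkl]
  refine Finset.sum_congr rfl fun j hj => ?_
  rw [hz.step j ((Finset.mem_Ico.1 hj).2.trans_le hl)]
  abel

lemma gridHolderOn_coeff (hz : IsGridSolution M K G γ h N z f w β) (hh : 0 ≤ h) (hγ : 0 ≤ γ)
    {B : ℝ} (hB : 0 ≤ B) {k l : ℕ} (hl : l < N) (hzB : GridHolderOn B γ h z k l) :
    GridHolderOn (K * (1 + B)) γ h f k l := by
  intro i j hi hij hj
  refine (hz.coeff_sub_le i j hij (hj.trans_lt hl) (B * (h * (j - i)) ^ γ)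
    fun p hip hpj => (hzB hi hip (hpj.trans hj)).trans ?_).trans_eq (by ring)
  have : 0 ≤ (p : ℝ) - i := sub_nonneg.2 (by exact_mod_cast hip)
  gcongr

lemma norm_sum_drift_le (hz : IsGridSolution M K G γ h N z f w β) {k l : ℕ} (hkl : k ≤ l)
    (hl : l ≤ N) : ‖∑ j ∈ Finset.Ico k l, β j‖ ≤ M * (h * (l - k)) := by
  refine (norm_sum_le_of_le _ fun j hj =>
    hz.drift_le j ((Finset.mem_Ico.1 hj).2.trans_le hl)).trans_eq ?_
  rw [Finset.sum_const, Nat.card_Ico, nsmul_eq_mul, Nat.cast_sub hkl]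
  ring

lemma norm_riemannSum_sub_le (hz : IsGridSolution M K G γ h N z f w β) (hh : 0 ≤ h) (hK : 0 ≤ K)
    (hG : 0 ≤ G) (hγ : 1 / 2 < γ) {B : ℝ} (hB : 0 ≤ B) {k l : ℕ} (hkl : k ≤ l) (hl : l < N)
    (hzB : GridHolderOn B γ h z k l) :
    ‖f k (w (l + 1) - w k) - ∑ j ∈ Finset.Ico k (l + 1), f j (w (j + 1) - w j)‖
      ≤ sewingConst (γ + γ) * (K * (1 + B) * G) * (h * (l + 1 - k)) ^ (γ + γ) :=
  _root_.norm_riemannSum_sub_le (by linarith) (by linarith) (by linarith) hh (by positivity) hG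
    hkl (hz.gridHolderOn_coeff hh (by linarith) hB hl hzB) (hz.driver.mono (Nat.zero_le k) hl)

lemma norm_succ_sub_le (hz : IsGridSolution M K G γ h N z f w β) (hh : 0 ≤ h) (hM : 0 ≤ M)
    (hK : 0 ≤ K) (hG : 0 ≤ G) (hγ : 1 / 2 < γ) (hγ1 : γ ≤ 1) {ε B : ℝ} (hε1 : ε ≤ 1) (hB : 0 ≤ B)
    (hεB : sewingConst (γ + γ) * (K * (1 + B) * G) * ε ^ γ ≤ 1) {k l : ℕ} (hkl : k ≤ l)
    (hl : l < N) (hlε : h * (l + 1 - k) ≤ ε) (hzB : GridHolderOn B γ h z k l) :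
    ‖z (l + 1) - z k‖ ≤ (M + M * G + 1) * (h * (l + 1 - k)) ^ γ := by
  set τ : ℝ := h * (l + 1 - k) with hτ
  have τ_nonneg : 0 ≤ τ := by
    have : (k : ℝ) ≤ l := by exact_mod_cast hkl
    exact mul_nonneg hh (by linarith)
  have sewing_pos : 0 < sewingConst (γ + γ) := sewingConst_pos (by linarith)
  have drift : ‖∑ j ∈ Finset.Ico k (l + 1), β j‖ ≤ M * τ ^ γ := by
    refine (hz.norm_sum_drift_le (by omega) hl).trans ?_
    push_cast
    exact mul_le_mul_of_nonneg_left
      (Real.self_le_rpow_of_le_one τ_nonneg (hlε.trans hε1) hγ1) hM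
  have leading : ‖f k (w (l + 1) - w k)‖ ≤ M * G * τ ^ γ := by
    calc ‖f k (w (l + 1) - w k)‖ ≤ ‖f k‖ * ‖w (l + 1) - w k‖ :=
          ContinuousLinearMap.le_opNorm _ _
      _ ≤ M * (G * τ ^ γ) := by
          gcongr
          · exact hz.coeff_le k (by omega)
          · simpa [hτ] using hz.driver (Nat.zero_le k) (by omega : k ≤ l + 1) hl
      _ = M * G * τ ^ γ := by ring
  have remainder : ‖f k (w (l + 1) - w k)
      - ∑ j ∈ Finset.Ico k (l + 1), f j (w (j + 1) - w j)‖ ≤ τ ^ γ := by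
    refine (hz.norm_riemannSum_sub_le hh hK hG hγ hB hkl hl hzB).trans ?_
    rw [← hτ, Real.rpow_add_of_nonneg τ_nonneg (by linarith) (by linarith), ← mul_assoc]
    refine mul_le_of_le_one_left (by positivity) (le_trans ?_ hεB)
    gcongr
  calc ‖z (l + 1) - z k‖
      = ‖∑ j ∈ Finset.Ico k (l + 1), β j + f k (w (l + 1) - w k)
          - (f k (w (l + 1) - w k) - ∑ j ∈ Finset.Ico k (l + 1), f j (w (j + 1) - w j))‖ := by
        rw [hz.sub_eq (by omega) hl]
        congr 1
        abel
    _ ≤ M * τ ^ γ + M * G * τ ^ γ + τ ^ γ :=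
        (norm_sub_le _ _).trans (add_le_add ((norm_add_le _ _).trans (add_le_add drift leading))
          remainder)
    _ = (M + M * G + 1) * τ ^ γ := by ring

lemma gridHolderOn_of_short (hz : IsGridSolution M K G γ h N z f w β) (hh : 0 ≤ h) (hM : 0 ≤ M)
    (hK : 0 ≤ K) (hG : 0 ≤ G) (hγ : 1 / 2 < γ) (hγ1 : γ ≤ 1) {ε : ℝ} (hε1 : ε ≤ 1)
    (hε : sewingConst (γ + γ) * (K * (1 + (M + M * G + 1)) * G) * ε ^ γ ≤ 1) {k l : ℕ}
    (hkl : k ≤ l) (hl : l ≤ N) (hlε : h * (l - k) ≤ ε) :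
    GridHolderOn (M + M * G + 1) γ h z k l := by
  have hB : 0 ≤ M + M * G + 1 := by positivity
  induction l, hkl using Nat.le_induction with
  | base =>
    intro i j hi hij hj
    obtain ⟨rfl, rfl⟩ : i = j ∧ j = k := by omega
    simpa using mul_nonneg hB (Real.rpow_nonneg le_rfl γ)
  | succ l _ ih =>
    push_cast at hlε
    intro i j hi hij hj
    have hzl := ih (by omega) (le_trans (by gcongr; linarith) hlε)
    obtain hjl | rfl : j ≤ l ∨ j = l + 1 := by omega
    · exact hzl hi hij hjl
    obtain rfl | hil : i = l + 1 ∨ i ≤ l := by omega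
    · simpa using mul_nonneg hB (Real.rpow_nonneg le_rfl γ)
    push_cast
    refine hz.norm_succ_sub_le hh hM hK hG hγ hγ1 hε1 hB hε hil hl (le_trans ?_ hlε)
      (hzl.mono hi le_rfl)
    gcongr

end IsGridSolution

lemma exists_pos_le_one_mul_rpow_le_one {A γ : ℝ} (hA : 0 ≤ A) (hγ : 0 < γ) :
    ∃ ε : ℝ, 0 < ε ∧ ε ≤ 1 ∧ A * ε ^ γ ≤ 1 := by
  refine ⟨((1 + A)⁻¹) ^ γ⁻¹, by positivity, Real.rpow_le_one (by positivity)
    (inv_le_one_of_one_le₀ (by linarith)) (by positivity), ?_⟩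
  rw [Real.rpow_inv_rpow (by positivity) hγ.ne', ← div_eq_mul_inv, div_le_one (by positivity)]
  linarith

/-- On intervals so short that the Young remainder is at most `(h * (l - k)) ^ γ`, the constant
`M + M * G + 1` reproduces itself, and finitely many such intervals cover `[0, T]`. -/
theorem exists_gridHolderOn_of_isGridSolution {M K G γ T : ℝ} (hM : 0 ≤ M) (hK : 0 ≤ K)
    (hG : 0 ≤ G) (hγ : 1 / 2 < γ) (hγ1 : γ ≤ 1) (hT : 0 ≤ T) :
    ∃ C ε : ℝ, 0 ≤ C ∧ 0 < ε ∧ ∀ (h : ℝ) (N : ℕ) (z : ℕ → V) (f : ℕ → U →L[ℝ] V) (w : ℕ → U)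
      (β : ℕ → V), IsGridSolution M K G γ h N z f w β → 0 < h → h ≤ ε → h * N ≤ T →
      GridHolderOn C γ h z 0 N := by
  have sewing_pos : 0 < sewingConst (γ + γ) := sewingConst_pos (by linarith)
  obtain ⟨ε, hε0, hε1, hε⟩ := exists_pos_le_one_mul_rpow_le_one (γ := γ)
    (show 0 ≤ sewingConst (γ + γ) * (K * (1 + (M + M * G + 1)) * G) by positivity) (by linarith)
  refine ⟨(2 / ε * T + 1) * (M + M * G + 1), ε, by positivity, hε0,
    fun h N z f w β hz hh hhε hN => ?_⟩
  exact gridHolderOn_of_forall_short (by linarith) (by positivity) hN hh hhε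
    fun i j hij hj hji => hz.gridHolderOn_of_short hh.le hM hK hG hγ hγ1 hε1 hε hij hj hji
      le_rfl hij le_rfl

end DiscreteYoung

section Regulator

/-- `y` is the regulator of the real path `z`: the running maximum `y t = max_{s ≤ t} (z s)⁻`, the
least non-decreasing push that keeps `z + y` nonnegative. -/
def IsRegulator {α : Type*} [LinearOrder α] (z y : α → ℝ) : Prop :=
  ∀ t, IsGreatest ((fun s => (z s)⁻) '' Iic t) (y t)

lemma negPart_le_negPart_add_abs_sub (a b : ℝ) : a⁻ ≤ b⁻ + |a - b| := by
  rw [negPart_def, negPart_def]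
  have := neg_abs_le (a - b)
  exact sup_le (by linarith [le_sup_left (a := -b) (b := (0 : ℝ))])
    (add_nonneg le_sup_right (abs_nonneg _))

namespace IsRegulator

variable {α : Type*} [LinearOrder α] {z y : α → ℝ} {s t : α}

lemma negPart_le (hy : IsRegulator z y) (hst : s ≤ t) : (z s)⁻ ≤ y t :=
  (hy t).2 (mem_image_of_mem _ hst)

lemma exists_eq (hy : IsRegulator z y) (t : α) : ∃ s ≤ t, y t = (z s)⁻ := by
  obtain ⟨s, hst, hs⟩ := (hy t).1
  exact ⟨s, hst, hs.symm⟩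

lemma monotone (hy : IsRegulator z y) : Monotone y := fun s t hst => by
  obtain ⟨u, hus, hu⟩ := hy.exists_eq s
  exact hu ▸ hy.negPart_le (hus.trans hst)

lemma nonneg (hy : IsRegulator z y) (t : α) : 0 ≤ y t :=
  (negPart_nonneg _).trans (hy.negPart_le le_rfl)

lemma add_nonneg (hy : IsRegulator z y) (t : α) : 0 ≤ z t + y t := by
  linarith [hy.negPart_le (le_refl t), neg_le_negPart (z t)]

lemma abs_sub_le (hy : IsRegulator z y) (hst : s ≤ t) {B : ℝ}
    (hB : ∀ u ∈ Icc s t, |z u - z s| ≤ B) : |y t - y s| ≤ B := by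
  rw [abs_of_nonneg (sub_nonneg.2 (hy.monotone hst)), sub_le_iff_le_add']
  obtain ⟨u, hut, hu⟩ := hy.exists_eq t
  have hB0 : 0 ≤ B := (abs_nonneg _).trans (hB s ⟨le_rfl, hst⟩)
  rw [hu]
  rcases le_total u s with hus | hsu
  · linarith [hy.negPart_le hus]
  · linarith [negPart_le_negPart_add_abs_sub (z u) (z s), hB u ⟨hsu, hut⟩,
      hy.negPart_le (le_refl s)]

lemma eq_of_forall_pos (hy : IsRegulator z y) (hst : s ≤ t)
    (hpos : ∀ u ∈ Icc s t, 0 < z u + y u) : y s = y t := by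
  refine le_antisymm (hy.monotone hst) ?_
  obtain ⟨u, hut, hu⟩ := hy.exists_eq t
  rcases le_total u s with hus | hsu
  · exact hu ▸ hy.negPart_le hus
  have no_push : (z u)⁻ = 0 := by
    have hzu := hpos u ⟨hsu, hut⟩
    have hyu := hy.monotone hut
    by_contra h
    have : z u < 0 := negPart_pos_iff.1 ((negPart_nonneg _).lt_of_ne' h)
    rw [negPart_of_nonpos this.le] at hu
    linarith
  exact (hu.trans no_push).trans_le (hy.nonneg s)

end IsRegulator

section Euclidean

variable {ι : Type*} [Fintype ι]

lemma norm_le_sqrt_card_mul {v : EuclideanSpace ℝ ι} {B : ℝ} (hB : 0 ≤ B)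
    (hv : ∀ i, |v i| ≤ B) : ‖v‖ ≤ √(Fintype.card ι) * B := by
  rw [EuclideanSpace.norm_eq, ← Real.sqrt_sq hB, ← Real.sqrt_mul (by positivity)]
  refine Real.sqrt_le_sqrt ((Finset.sum_le_card_nsmul _ _ (B ^ 2) fun i _ => ?_).trans_eq
    (by rw [nsmul_eq_mul, Finset.card_univ]))
  exact pow_le_pow_left₀ (norm_nonneg _) (hv i) 2

lemma norm_add_sub_add_le_of_isRegulator {α : Type*} [LinearOrder α]
    {z y : α → EuclideanSpace ℝ ι} (hy : ∀ i, IsRegulator (fun t => z t i) fun t => y t i)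
    {s t : α} (hst : s ≤ t) {B : ℝ} (hB : ∀ u ∈ Icc s t, ‖z u - z s‖ ≤ B) :
    ‖z t + y t - (z s + y s)‖ ≤ (1 + √(Fintype.card ι)) * B := by
  have hB0 : 0 ≤ B := (norm_nonneg _).trans (hB s ⟨le_rfl, hst⟩)
  calc ‖z t + y t - (z s + y s)‖ ≤ ‖z t - z s‖ + ‖y t - y s‖ := by
        rw [add_sub_add_comm]
        exact norm_add_le _ _
    _ ≤ B + √(Fintype.card ι) * B :=
        add_le_add (hB t ⟨hst, le_rfl⟩) (norm_le_sqrt_card_mul hB0 fun i =>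
          (hy i).abs_sub_le hst fun u hu => (PiLp.norm_apply_le (z u - z s) i).trans (hB u hu))
    _ = (1 + √(Fintype.card ι)) * B := by ring

end Euclidean

section Continuous

variable {α : Type*} [LinearOrder α] [TopologicalSpace α] [OrderTopology α] [CompactSpace α]

lemma continuous_sSup_negPart_inf {X : Type*} [TopologicalSpace X] {z : X → C(α, ℝ)} {t : X → α}
    (hz : Continuous z) (ht : Continuous t) :
    Continuous fun x => sSup ((fun s => (z x (s ⊓ t x))⁻) '' univ) :=
  isCompact_univ.continuous_sSup (f := fun x s => (z x (s ⊓ t x))⁻) <| by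
    simp only [negPart_def]
    fun_prop

/-- The regulator of a continuous path. The supremum over `s ≤ t` is written as the supremum of
`(z (s ⊓ t))⁻` over all `s`, which makes the joint continuity in `z` and `t` evident. -/
noncomputable def regulator (z : C(α, ℝ)) : C(α, ℝ) where
  toFun t := sSup ((fun s => (z (s ⊓ t))⁻) '' univ)
  continuous_toFun := continuous_sSup_negPart_inf continuous_const continuous_id

lemma isRegulator_regulator (z : C(α, ℝ)) : IsRegulator z (regulator z) := fun t => by
  have image_eq : (fun s => (z (s ⊓ t))⁻) '' univ = (fun s => (z s)⁻) '' Iic t := by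
    ext r
    constructor
    · rintro ⟨s, -, rfl⟩
      exact ⟨s ⊓ t, inf_le_right, rfl⟩
    · rintro ⟨s, hst, rfl⟩
      exact ⟨s, mem_univ s, by simp only [inf_of_le_left hst]⟩
  have hz : Continuous fun s => (z s)⁻ := by
    simp only [negPart_def]
    fun_prop
  change IsGreatest _ (sSup ((fun s => (z (s ⊓ t))⁻) '' univ))
  rw [image_eq]
  exact (isClosed_Iic.isCompact.image hz).isGreatest_sSup (nonempty_Iic.image _)

lemma continuous_regulator : Continuous (regulator : C(α, ℝ) → C(α, ℝ)) :=
  ContinuousMap.continuous_of_continuous_uncurry _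
    (continuous_sSup_negPart_inf continuous_fst continuous_snd)

variable {ι : Type*}

/-- The coordinatewise regulator of a continuous path, for reflection in the nonnegative
orthant. -/
noncomputable def orthantRegulator (z : C(α, EuclideanSpace ℝ ι)) :
    C(α, EuclideanSpace ℝ ι) where
  toFun t := WithLp.toLp 2 fun i => regulator ⟨fun s => z s i, by fun_prop⟩ t

lemma isRegulator_orthantRegulator (z : C(α, EuclideanSpace ℝ ι)) (i : ι) :
    IsRegulator (fun t => z t i) fun t => orthantRegulator z t i :=
  isRegulator_regulator ⟨fun s => z s i, by fun_prop⟩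

lemma continuous_orthantRegulator :
    Continuous (orthantRegulator : C(α, EuclideanSpace ℝ ι) → C(α, EuclideanSpace ℝ ι)) := by
  have coordinate (i : ι) : Continuous fun z : C(α, EuclideanSpace ℝ ι) =>
      regulator (⟨fun s => z s i, by fun_prop⟩ : C(α, ℝ)) :=
    continuous_regulator.comp
      (ContinuousMap.continuous_postcomp (⟨fun v : EuclideanSpace ℝ ι => v i, by fun_prop⟩))
  refine ContinuousMap.continuous_of_continuous_uncurry _
    ((PiLp.continuous_toLp 2 _).comp (continuous_pi fun i => ?_))
  exact ((coordinate i).comp continuous_fst).eval continuous_snd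

/-- The Skorokhod map of the nonnegative orthant, sending an unreflected path to the reflected
one. -/
noncomputable def skorokhodMap [Fintype ι] (z : C(α, EuclideanSpace ℝ ι)) :
    C(α, EuclideanSpace ℝ ι) :=
  z + orthantRegulator z

lemma continuous_skorokhodMap [Fintype ι] :
    Continuous (skorokhodMap : C(α, EuclideanSpace ℝ ι) → C(α, EuclideanSpace ℝ ι)) :=
  continuous_id.add continuous_orthantRegulator

end Continuous

section Complementarity

variable {a b : ℝ} {z y : C(Icc a b, ℝ)}

/-- The regulator of a continuous path on `[a, b]`, extended by constants to the real line. -/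
noncomputable def regulatorStieltjes (hab : a ≤ b) (hy : IsRegulator z y) :
    StieltjesFunction ℝ where
  toFun := IccExtend hab y
  mono' := hy.monotone.IccExtend hab
  right_continuous' _ := (y.continuous.Icc_extend' (h := hab)).continuousWithinAt

lemma regulatorStieltjes_measure_pos (hab : a ≤ b) (hy : IsRegulator z y) :
    (regulatorStieltjes hab hy).measure {s | 0 < IccExtend hab (z + y) s} = 0 := by
  have is_open : IsOpen {s | 0 < IccExtend hab (z + y) s} :=
    isOpen_lt continuous_const ((z + y).continuous.Icc_extend' (h := hab))
  refine measure_null_of_locally_null _ fun s hs => ?_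
  obtain ⟨l, u, hlsu, h_sub⟩ := mem_nhds_iff_exists_Ioo_subset.1 (is_open.mem_nhds hs)
  obtain ⟨p, hlp, hps⟩ := exists_between hlsu.1
  obtain ⟨q, hsq, hqu⟩ := exists_between hlsu.2
  refine ⟨Ioc p q, mem_nhdsWithin_of_mem_nhds (Ioc_mem_nhds hps hsq), ?_⟩
  have constant : y (projIcc a b hab p) = y (projIcc a b hab q) := by
    refine hy.eq_of_forall_pos (monotone_projIcc hab (hps.trans hsq).le) fun r hr => ?_
    obtain ⟨v, hv, rfl⟩ := intermediate_value_Icc (hps.trans hsq).le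
      (continuous_projIcc (h := hab)).continuousOn hr
    exact h_sub ⟨hlp.trans_le hv.1, hv.2.trans_lt hqu⟩
  rw [StieltjesFunction.measure_Ioc, ENNReal.ofReal_eq_zero]
  exact (sub_eq_zero.2 constant.symm).le

lemma lintegral_regulatorStieltjes (hab : a ≤ b) (hy : IsRegulator z y) :
    ∫⁻ s, ENNReal.ofReal (IccExtend hab (z + y) s) ∂(regulatorStieltjes hab hy).measure = 0 := by
  refine lintegral_eq_zero_of_ae_eq_zero ?_
  filter_upwards [measure_eq_zero_iff_ae_notMem.1 (regulatorStieltjes_measure_pos hab hy)]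
    with s hs
  exact ENNReal.ofReal_of_nonpos (not_lt.1 hs)

end Complementarity

lemma isSkorokhodSolution_skorokhodMap {d : ℕ} {T : ℝ} (hT : 0 ≤ T)
    (z : C(Icc 0 T, EuclideanSpace ℝ (Fin d))) (h0 : ∀ i, 0 ≤ z ⟨0, left_mem_Icc.2 hT⟩ i) :
    IsSkorokhodSolution T (IccExtend hT z) (IccExtend hT (skorokhodMap z))
      (IccExtend hT (orthantRegulator z)) where
  continuousOn_z := (z.continuous.Icc_extend' (h := hT)).continuousOn
  continuousOn_x := ((skorokhodMap z).continuous.Icc_extend' (h := hT)).continuousOn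
  continuousOn_y := ((orthantRegulator z).continuous.Icc_extend' (h := hT)).continuousOn
  start_nonneg i := by
    rw [IccExtend_left]
    exact h0 i
  eq_add t _ := rfl
  nonneg t _ i := (isRegulator_orthantRegulator z i).add_nonneg _
  regulator_zero i := by
    obtain ⟨s, hs, h⟩ := (isRegulator_orthantRegulator z i).exists_eq ⟨0, left_mem_Icc.2 hT⟩
    obtain rfl : s = ⟨0, left_mem_Icc.2 hT⟩ := le_antisymm hs s.2.1
    rw [IccExtend_left, h, negPart_eq_zero]
    exact h0 i
  regulator_mono i := ((isRegulator_orthantRegulator z i).monotone.IccExtend hT).monotoneOn _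
  complementary i := by
    have hy : IsRegulator (⟨fun t => z t i, by fun_prop⟩ : C(Icc 0 T, ℝ))
      (⟨fun t => orthantRegulator z t i, by fun_prop⟩ : C(Icc 0 T, ℝ)) :=
      isRegulator_orthantRegulator z i
    refine ⟨regulatorStieltjes hT hy, fun t _ => rfl, fun t _ => ?_⟩
    exact le_antisymm ((setLIntegral_le_lintegral _ _).trans_eq
      (lintegral_regulatorStieltjes hT hy)) bot_le

lemma isGreatest_image_Icc_of_isRegulator {T : ℝ} (hT : 0 ≤ T) {z y : Icc 0 T → ℝ}
    (hy : IsRegulator z y) {t : ℝ} (ht : t ∈ Icc 0 T) :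
    IsGreatest ((fun s => (IccExtend hT z s)⁻) '' Icc 0 t) (IccExtend hT y t) := by
  have hzs {s : ℝ} (hs : s ∈ Icc 0 T) : IccExtend hT z s = z ⟨s, hs⟩ := IccExtend_of_mem hT z hs
  rw [IccExtend_of_mem hT y ht]
  obtain ⟨s, hst, hs⟩ := hy.exists_eq ⟨t, ht⟩
  refine ⟨⟨s, ⟨s.2.1, hst⟩, by simp only [hzs s.2, Subtype.coe_eta, hs]⟩, ?_⟩
  rintro _ ⟨u, hu, rfl⟩
  have hu' : u ∈ Icc 0 T := ⟨hu.1, hu.2.trans ht.2⟩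
  simp only [hzs hu']
  exact hy.negPart_le (Subtype.mk_le_mk.2 hu.2)

end Regulator

/-! ### Hölder paths -/

lemma holderWith_of_dist_le {E : Type*} [PseudoMetricSpace E] {S : Set ℝ} {f : S → E} {C γ : ℝ≥0}
    (hf : ∀ s t : S, s ≤ t → dist (f s) (f t) ≤ C * ((t : ℝ) - s) ^ (γ : ℝ)) :
    HolderWith C γ f := by
  intro s t
  wlog hst : s ≤ t generalizing s t
  · rw [edist_comm, edist_comm s]
    exact this t s (le_of_not_ge hst)
  have hle : dist (f s) (f t) ≤ C * dist s t ^ (γ : ℝ) := by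
    rw [dist_comm s, Subtype.dist_eq, Real.dist_eq,
      abs_of_nonneg (sub_nonneg.2 (Subtype.coe_le_coe.2 hst))]
    exact hf s t hst
  rw [edist_nndist, edist_nndist, ← ENNReal.coe_rpow_of_nonneg _ γ.coe_nonneg]
  exact_mod_cast hle

lemma isClosed_setOf_holderWith {X E : Type*} [PseudoEMetricSpace X] [PseudoEMetricSpace E]
    (C γ : ℝ≥0) : IsClosed {φ : X → E | HolderWith C γ φ} := by
  simp only [HolderWith, Set.ofPred_forall]
  exact isClosed_iInter fun s => isClosed_iInter fun t => isClosed_le (by fun_prop) continuous_const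

lemma isClosed_setOf_continuousMap_holderWith {X E : Type*} [PseudoEMetricSpace X]
    [PseudoEMetricSpace E] (C γ : ℝ≥0) : IsClosed {f : C(X, E) | HolderWith C γ f} :=
  (isClosed_setOf_holderWith C γ).preimage continuous_coeFun

section PolygonalPath

variable {E : Type*} [NormedAddCommGroup E] [NormedSpace ℝ E]

/-- The piecewise linear path through the points `v 0, …, v N` at the times `0, …, N`. Writing it as
a sum of clipped increments makes it visibly continuous in `v` and the time jointly. -/
noncomputable def polygonalPath (N : ℕ) (v : ℕ → E) (t : ℝ) : E :=
  v 0 + ∑ k ∈ Finset.range N, (projIcc (0 : ℝ) 1 zero_le_one (t - k) : ℝ) • (v (k + 1) - v k)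

lemma continuous_uncurry_polygonalPath (N : ℕ) :
    Continuous fun p : (ℕ → E) × ℝ => polygonalPath N p.1 p.2 := by
  unfold polygonalPath
  have : Continuous fun t => (projIcc (0 : ℝ) 1 zero_le_one t : ℝ) :=
    continuous_subtype_val.comp continuous_projIcc
  fun_prop

lemma polygonalPath_eq {N k : ℕ} (v : ℕ → E) (hk : k < N) {t : ℝ} (ht : t ∈ Icc (k : ℝ) (k + 1)) :
    polygonalPath N v t = v k + (t - k) • (v (k + 1) - v k) := by
  have hbefore : ∑ j ∈ Finset.range k,
      (projIcc (0 : ℝ) 1 zero_le_one (t - j) : ℝ) • (v (j + 1) - v j) = v k - v 0 := by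
    rw [← Finset.sum_range_sub]
    refine Finset.sum_congr rfl fun j hj => ?_
    have : (j : ℝ) + 1 ≤ k := by exact_mod_cast Finset.mem_range.1 hj
    rw [projIcc_of_right_le _ (by linarith [ht.1]), one_smul]
  have hafter : ∑ j ∈ Finset.Ico (k + 1) N,
      (projIcc (0 : ℝ) 1 zero_le_one (t - j) : ℝ) • (v (j + 1) - v j) = 0 := by
    refine Finset.sum_eq_zero fun j hj => ?_
    have : (k : ℝ) + 1 ≤ j := by exact_mod_cast (Finset.mem_Ico.1 hj).1
    rw [projIcc_of_le_left _ (by linarith [ht.2]), zero_smul]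
  rw [polygonalPath, ← Finset.sum_range_add_sum_Ico _ (Nat.succ_le_of_lt hk), hafter, add_zero,
    Finset.sum_range_succ, hbefore,
    projIcc_of_mem zero_le_one ⟨by linarith [ht.1], by linarith [ht.2]⟩]
  abel

lemma polygonalPath_natCast {N k : ℕ} (v : ℕ → E) (hk : k ≤ N) : polygonalPath N v k = v k := by
  cases k with
  | zero =>
    have hclip : ∀ j : ℕ, (projIcc (0 : ℝ) 1 zero_le_one (0 - j) : ℝ) = 0 := fun j => by
      rw [projIcc_of_le_left _ (by simp)]
    simp [polygonalPath, -zero_sub, hclip]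
  | succ k => rw [polygonalPath_eq v hk ⟨by simp, by simp⟩]; simp

lemma exists_nat_lt_mem_Icc {N : ℕ} (hN : N ≠ 0) {t : ℝ} (ht : t ∈ Icc (0 : ℝ) N) :
    ∃ k < N, t ∈ Icc (k : ℝ) (k + 1) := by
  rcases ht.2.eq_or_lt with rfl | hlt
  · obtain ⟨k, rfl⟩ := Nat.exists_eq_succ_of_ne_zero hN
    exact ⟨k, k.lt_succ_self, by simp⟩
  · exact ⟨⌊t⌋₊, (Nat.floor_lt ht.1).2 hlt, Nat.floor_le ht.1, (Nat.lt_floor_add_one t).le⟩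

section Holder

variable {N : ℕ} {C γ h : ℝ} {v : ℕ → E}

lemma GridHolderOn.norm_polygonalPath_sub_le_of_mem_cell (hv : GridHolderOn C γ h v 0 N)
    (hh : 0 ≤ h) (hγ1 : γ ≤ 1) {k : ℕ} (hk : k < N) {s t : ℝ} (hst : s ≤ t)
    (hs : s ∈ Icc (k : ℝ) (k + 1)) (ht : t ∈ Icc (k : ℝ) (k + 1)) :
    ‖polygonalPath N v t - polygonalPath N v s‖ ≤ C * (h * (t - s)) ^ γ := by
  have hstep : ‖v (k + 1) - v k‖ ≤ C * h ^ γ := by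
    simpa using hv (Nat.zero_le k) k.le_succ (Nat.succ_le_of_lt hk)
  have hlen : 0 ≤ t - s := sub_nonneg.2 hst
  rw [polygonalPath_eq v hk hs, polygonalPath_eq v hk ht, add_sub_add_left_eq_sub, ← sub_smul,
    sub_sub_sub_cancel_right, norm_smul, Real.norm_of_nonneg hlen, Real.mul_rpow hh hlen]
  calc (t - s) * ‖v (k + 1) - v k‖ ≤ (t - s) ^ γ * (C * h ^ γ) := by
        gcongr
        exact Real.self_le_rpow_of_le_one hlen (by linarith [hs.1, ht.2]) hγ1
    _ = C * (h ^ γ * (t - s) ^ γ) := by ring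

lemma GridHolderOn.norm_polygonalPath_sub_natCast_le (hv : GridHolderOn C γ h v 0 N) (hC : 0 ≤ C)
    (hh : 0 ≤ h) (hγ : 0 < γ) (hγ1 : γ ≤ 1) {k : ℕ} {t : ℝ} (hkt : k ≤ t) (htN : t ≤ N) :
    ‖polygonalPath N v t - v k‖ ≤ 2 * C * (h * (t - k)) ^ γ := by
  have hkN : k ≤ N := by exact_mod_cast hkt.trans htN
  rcases hkt.eq_or_lt with rfl | hlt
  · simp [polygonalPath_natCast v hkN, Real.zero_rpow hγ.ne']
  have hN : N ≠ 0 := by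
    rintro rfl
    exact (hlt.trans_le htN).not_ge (by simp)
  obtain ⟨l, hlN, hl⟩ := exists_nat_lt_mem_Icc hN ⟨k.cast_nonneg.trans hkt, htN⟩
  have hkl : k ≤ l := by
    have : (k : ℝ) < l + 1 := hlt.trans_le hl.2
    exact Nat.lt_succ_iff.1 (by exact_mod_cast this)
  have hkl' : (k : ℝ) ≤ l := by exact_mod_cast hkl
  have hgrid : ‖v l - v k‖ ≤ C * (h * (t - k)) ^ γ := by
    refine (hv k.zero_le hkl hlN.le).trans ?_
    have := sub_nonneg.2 hkl'
    gcongr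
    exact hl.1
  have hcell : ‖polygonalPath N v t - v l‖ ≤ C * (h * (t - k)) ^ γ := by
    rw [← polygonalPath_natCast v hlN.le]
    refine (hv.norm_polygonalPath_sub_le_of_mem_cell hh hγ1 hlN hl.1 (by simp) hl).trans ?_
    have := sub_nonneg.2 hl.1
    gcongr
  linarith [norm_sub_le_norm_sub_add_norm_sub (polygonalPath N v t) (v l) (v k)]

lemma GridHolderOn.norm_polygonalPath_sub_le (hv : GridHolderOn C γ h v 0 N) (hC : 0 ≤ C)
    (hh : 0 ≤ h) (hγ : 0 < γ) (hγ1 : γ ≤ 1) {s t : ℝ} (hs : 0 ≤ s) (hst : s ≤ t) (ht : t ≤ N) :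
    ‖polygonalPath N v t - polygonalPath N v s‖ ≤ 3 * C * (h * (t - s)) ^ γ := by
  rcases eq_or_ne N 0 with rfl | hN
  · rw [show s = t by push_cast at ht; linarith, sub_self, norm_zero, sub_self, mul_zero,
      Real.zero_rpow hγ.ne', mul_zero]
  obtain ⟨k, hkN, hk⟩ := exists_nat_lt_mem_Icc hN ⟨hs, hst.trans ht⟩
  rcases le_total t (k + 1) with htk | htk
  · have := hv.norm_polygonalPath_sub_le_of_mem_cell hh hγ1 hkN hst hk ⟨hk.1.trans hst, htk⟩
    linarith [(norm_nonneg _).trans this]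
  · have hk2 : 0 ≤ (k : ℝ) + 1 - s := sub_nonneg.2 hk.2
    have : 0 ≤ t - (k + 1) := sub_nonneg.2 htk
    have hlast : ‖polygonalPath N v t - v (k + 1)‖ ≤ 2 * C * (h * (t - s)) ^ γ := by
      refine (hv.norm_polygonalPath_sub_natCast_le hC hh hγ hγ1
        (by rwa [Nat.cast_succ]) ht).trans ?_
      push_cast
      gcongr
      exact hk.2
    have hfirst : ‖v (k + 1) - polygonalPath N v s‖ ≤ C * (h * (t - s)) ^ γ := by
      rw [← polygonalPath_natCast v (Nat.succ_le_of_lt hkN), Nat.cast_succ]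
      refine (hv.norm_polygonalPath_sub_le_of_mem_cell hh hγ1 hkN hk.2 hk (by simp)).trans ?_
      gcongr
    linarith [norm_sub_le_norm_sub_add_norm_sub (polygonalPath N v t) (v (k + 1))
      (polygonalPath N v s)]

end Holder

lemma polygonalPath_apply {ι : Type*} [Fintype ι] (N : ℕ) (v : ℕ → EuclideanSpace ℝ ι) (t : ℝ)
    (i : ι) : polygonalPath N v t i = polygonalPath N (fun k => v k i) t := by
  simp [polygonalPath]

lemma IsRegulator.negPart_polygonalPath_le {z y : ℕ → ℝ} (hy : IsRegulator z y) {N k : ℕ}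
    (hk : k ≤ N) {t : ℝ} (ht : t ∈ Icc (0 : ℝ) k) : (polygonalPath N z t)⁻ ≤ y k := by
  rcases eq_or_ne k 0 with rfl | hk0
  · obtain rfl : t = (0 : ℕ) := le_antisymm ht.2 (by simpa using ht.1)
    rw [polygonalPath_natCast z hk]
    exact hy.negPart_le le_rfl
  obtain ⟨j, hj, hjt⟩ := exists_nat_lt_mem_Icc hk0 ht
  rw [polygonalPath_eq z (hj.trans_le hk) hjt]
  have hleft : -z j ≤ y k := (neg_le_negPart _).trans (hy.negPart_le hj.le)
  have hright : -z (j + 1) ≤ y k := (neg_le_negPart _).trans (hy.negPart_le (Nat.succ_le_of_lt hj))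
  rw [negPart_def, sup_le_iff, smul_eq_mul]
  refine ⟨?_, (negPart_nonneg _).trans (hy.negPart_le le_rfl)⟩
  nlinarith [hjt.1, hjt.2]

end PolygonalPath

section PolygonalMap

variable {E : Type*} [NormedAddCommGroup E] [NormedSpace ℝ E] {T h : ℝ} {N : ℕ}

/-- The piecewise linear path on `[0, T]` through `v 0, …, v N` at the times `0, h, …, N h`. -/
noncomputable def polygonalMap (T h : ℝ) (N : ℕ) (v : ℕ → E) : C(Icc (0 : ℝ) T, E) where
  toFun t := polygonalPath N v (t / h)
  continuous_toFun := (continuous_uncurry_polygonalPath N).comp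
    (continuous_const.prodMk (continuous_subtype_val.div_const h))

lemma continuous_polygonalMap : Continuous (polygonalMap (E := E) T h N) :=
  ContinuousMap.continuous_of_continuous_uncurry _ <| (continuous_uncurry_polygonalPath N).comp <|
    continuous_fst.prodMk ((continuous_subtype_val.comp continuous_snd).div_const h)

lemma polygonalMap_congr {v w : ℕ → E} (hvw : ∀ k ≤ N, v k = w k) :
    polygonalMap T h N v = polygonalMap T h N w := by
  ext t
  refine congrArg₂ (· + ·) (hvw 0 N.zero_le) (Finset.sum_congr rfl fun k hk => ?_)
  rw [hvw k (Finset.mem_range.1 hk).le, hvw (k + 1) (Finset.mem_range.1 hk)]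

lemma aemeasurable_polygonalMap [SecondCountableTopology E] [MeasurableSpace E] [BorelSpace E]
    [MeasurableSpace C(Icc (0 : ℝ) T, E)] [BorelSpace C(Icc (0 : ℝ) T, E)] {Ω : Type*}
    [MeasurableSpace Ω] {P : Measure Ω} {v : Ω → ℕ → E}
    (hv : ∀ k ≤ N, AEMeasurable (fun ω => v ω k) P) :
    AEMeasurable (fun ω => polygonalMap T h N (v ω)) P := by
  have hmin : (fun ω => polygonalMap T h N (v ω)) =
      fun ω => polygonalMap T h N fun k => v ω (min k N) :=
    funext fun ω => polygonalMap_congr fun k hk => by rw [min_eq_left hk]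
  rw [hmin]
  exact continuous_polygonalMap.measurable.comp_aemeasurable
    (aemeasurable_pi_iff.2 fun k => hv _ (min_le_right k N))

lemma polygonalMap_grid (hh : h ≠ 0) (v : ℕ → E) {k : ℕ} (hk : k ≤ N)
    (hkT : h * k ∈ Icc (0 : ℝ) T) : polygonalMap T h N v ⟨h * k, hkT⟩ = v k := by
  simp [polygonalMap, mul_div_cancel_left₀ _ hh, polygonalPath_natCast v hk]

lemma GridHolderOn.holderWith_polygonalMap {C γ : ℝ≥0} {v : ℕ → E}
    (hv : GridHolderOn C γ h v 0 N) (hh : 0 < h) (hT : T ≤ h * N) (hγ : 0 < γ) (hγ1 : γ ≤ 1) :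
    HolderWith (3 * C) γ (polygonalMap T h N v) := by
  refine holderWith_of_dist_le fun s t hst => ?_
  rw [dist_comm, dist_eq_norm]
  have htN : (t : ℝ) / h ≤ N := by
    rw [div_le_iff₀' hh]
    exact t.2.2.trans hT
  have := hv.norm_polygonalPath_sub_le C.2 hh.le (NNReal.coe_pos.2 hγ) (by exact_mod_cast hγ1)
    (div_nonneg s.2.1 hh.le) (div_le_div_of_nonneg_right (Subtype.coe_le_coe.2 hst) hh.le) htN
  rw [← sub_div, mul_div_cancel₀ _ hh.ne'] at this
  exact_mod_cast this

lemma orthantRegulator_polygonalMap_grid {ι : Type*} [Fintype ι] {z y : ℕ → EuclideanSpace ℝ ι}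
    (hy : ∀ i, IsRegulator (fun k => z k i) fun k => y k i) (hh : 0 < h) {k : ℕ} (hk : k ≤ N)
    (hkT : h * k ∈ Icc (0 : ℝ) T) :
    orthantRegulator (polygonalMap T h N z) ⟨h * k, hkT⟩ = y k := by
  ext i
  refine (isRegulator_orthantRegulator (polygonalMap T h N z) i ⟨h * k, hkT⟩).unique ⟨?_, ?_⟩
  · obtain ⟨j, hjk, hj⟩ := (hy i).exists_eq k
    have hle : h * j ≤ h * k := by gcongr
    have hjT : h * j ∈ Icc (0 : ℝ) T := ⟨by positivity, hle.trans hkT.2⟩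
    exact ⟨⟨h * j, hjT⟩, hle, by rw [hj, ← polygonalMap_grid hh.ne' z (hjk.trans hk) hjT]⟩
  · rintro _ ⟨s, hs, rfl⟩
    have hsk : (s : ℝ) / h ≤ k := (div_le_iff₀' hh).2 hs
    change (polygonalPath N z (s / h) i)⁻ ≤ y k i
    rw [polygonalPath_apply]
    exact (hy i).negPart_polygonalPath_le hk ⟨div_nonneg s.2.1 hh.le, hsk⟩

end PolygonalMap

namespace HolderSpace

variable {E : Type*} [NormedAddCommGroup E] {r γ C : ℝ≥0} {T : ℝ}

open Classical in
/-- A continuous path as an element of the Hölder space, with the junk value `0` if the path is not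
`r`-Hölder. -/
noncomputable def ofContinuousMap (r : ℝ≥0) (f : C(Icc (0 : ℝ) T, E)) : HolderSpace r T E :=
  if hf : f ∈ holderAddSubgroup r T E then ⟨f, hf⟩ else 0

lemma ofContinuousMap_val {f : C(Icc (0 : ℝ) T, E)} (hf : MemHolder r f) :
    (ofContinuousMap r f).1 = f :=
  congrArg Subtype.val (dif_pos hf)

lemma norm_ofContinuousMap_sub_le {f g : C(Icc (0 : ℝ) T, E)} (hf : HolderWith C γ f)
    (hg : HolderWith C γ g) (hr : r ≤ γ) (hγ : 0 < γ) :
    ‖ofContinuousMap r f - ofContinuousMap r g‖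
      ≤ ‖f - g‖ + (2 * C) ^ (r / γ : ℝ) * (2 * ‖f - g‖) ^ (1 - r / γ : ℝ) := by
  have hle : r / γ ≤ 1 := div_le_one_of_le₀ hr zero_le
  have hholder : HolderWith (2 * C) γ (f - g) := fun s t => by
    rw [ContinuousMap.sub_apply, ContinuousMap.sub_apply, sub_eq_add_neg, sub_eq_add_neg]
    refine (edist_add_add_le _ _ _ _).trans ?_
    rw [edist_neg_neg, two_mul, ENNReal.coe_add, add_mul]
    exact add_le_add (hf s t) (hg s t)
  have hbounded : HolderWith (2 * ‖f - g‖₊) 0 (f - g) := fun s t => by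
    rw [NNReal.coe_zero, ENNReal.rpow_zero, mul_one, edist_nndist, ENNReal.coe_le_coe, two_mul]
    exact (nndist_eq_nnnorm _ _).trans_le <| (nnnorm_sub_le _ _).trans
      (add_le_add ((f - g).norm_coe_le_norm s) ((f - g).norm_coe_le_norm t))
  have hinterp := hholder.interpolate hbounded (add_tsub_cancel_of_le hle)
  rw [mul_div_cancel₀ _ hγ.ne', zero_mul, add_zero] at hinterp
  have hval : (ofContinuousMap r f - ofContinuousMap r g).1 = f - g :=
    congrArg₂ (· - ·) (ofContinuousMap_val (hf.memHolder.of_le hr))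
      (ofContinuousMap_val (hg.memHolder.of_le hr))
  change ‖(ofContinuousMap r f - ofContinuousMap r g).1‖
    + (nnHolderNorm r (ofContinuousMap r f - ofContinuousMap r g).1 : ℝ) ≤ _
  rw [hval]
  have := NNReal.coe_le_coe.2 hinterp.nnholderNorm_le
  push_cast [NNReal.coe_sub hle] at this
  exact add_le_add le_rfl this

lemma continuousOn_ofContinuousMap (hr : r < γ) :
    ContinuousOn (ofContinuousMap (E := E) (T := T) r) {f | HolderWith C γ f} := by
  intro f hf
  rw [ContinuousWithinAt, tendsto_iff_norm_sub_tendsto_zero]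
  have hγ : 0 < γ := zero_le.trans_lt hr
  have hpos : (0 : ℝ) < 1 - r / γ := by
    rw [sub_pos, div_lt_one (NNReal.coe_pos.2 hγ)]
    exact_mod_cast hr
  have hbound : Continuous fun g : C(Icc (0 : ℝ) T, E) =>
      ‖g - f‖ + (2 * C) ^ (r / γ : ℝ) * (2 * ‖g - f‖) ^ (1 - r / γ : ℝ) := by
    have : Continuous fun g : C(Icc (0 : ℝ) T, E) => (2 * ‖g - f‖) ^ (1 - r / γ : ℝ) :=
      Continuous.rpow_const (by fun_prop) fun _ => Or.inr hpos.le
    fun_prop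
  have hlim := hbound.tendsto f
  simp only [sub_self, norm_zero, mul_zero, Real.zero_rpow hpos.ne', add_zero] at hlim
  refine squeeze_zero' (.of_forall fun _ => norm_nonneg _) ?_ (hlim.mono_left nhdsWithin_le_nhds)
  filter_upwards [self_mem_nhdsWithin] with g hg
  exact norm_ofContinuousMap_sub_le hg hf hr.le hγ

lemma aestronglyMeasurable_ofContinuousMap_comp [SecondCountableTopology E] {Ω : Type*}
    [MeasurableSpace Ω] {P : Measure Ω} {Z : Ω → C(Icc (0 : ℝ) T, E)}
    (hZ : AEStronglyMeasurable Z P) (hr : r < γ) (hZγ : ∀ᵐ ω ∂P, MemHolder γ (Z ω)) :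
    AEStronglyMeasurable (fun ω => ofContinuousMap r (Z ω)) P := by
  borelize C(Icc (0 : ℝ) T, E)
  have hcover : ∀ᵐ f ∂P.map Z, f ∈ ⋃ n : ℕ, {f : C(Icc (0 : ℝ) T, E) | HolderWith n γ f} := by
    refine (ae_map_iff hZ.aemeasurable (MeasurableSet.iUnion fun n : ℕ =>
      (isClosed_setOf_continuousMap_holderWith n γ).measurableSet)).2 ?_
    filter_upwards [hZγ] with ω ⟨C, hC⟩
    obtain ⟨n, hn⟩ := exists_nat_ge C
    exact mem_iUnion.2 ⟨n, hC.mono hn⟩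
  refine AEStronglyMeasurable.comp_aemeasurable (g := ofContinuousMap r) ?_ hZ.aemeasurable
  rw [← Measure.restrict_eq_self_of_ae_mem hcover, aestronglyMeasurable_iUnion_iff]
  exact fun n : ℕ => (continuousOn_ofContinuousMap hr).aestronglyMeasurable
    (isClosed_setOf_continuousMap_holderWith n γ).measurableSet

end HolderSpace

/-! ### Measurable selection of cluster points -/

section ClusterPoint

open Filter Topology TopologicalSpace

variable {Ω S : Type*} [MeasurableSpace Ω]

lemma measurableSet_frequently_atTop {p : ℕ → Ω → Prop} (hp : ∀ n, MeasurableSet {ω | p n ω}) :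
    MeasurableSet {ω | ∃ᶠ n in atTop, p n ω} := by
  have : {ω | ∃ᶠ n in atTop, p n ω} = limsup (fun n => {ω | p n ω}) atTop := by
    ext ω
    exact mem_limsup_iff_frequently_mem.symm
  exact this ▸ MeasurableSet.measurableSet_limsup hp

lemma measurable_nat_sInf {s : Ω → Set ℕ} (hs : ∀ i, MeasurableSet {ω | i ∈ s ω}) :
    Measurable fun ω => sInf (s ω) := by
  classical
  have hempty : MeasurableSet {ω | s ω = ∅} := by
    simp only [Set.eq_empty_iff_forall_notMem, Set.ofPred_forall]
    exact MeasurableSet.iInter fun i => (hs i).compl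
  have hex (ω) : ∃ i, i ∈ s ω ∨ s ω = ∅ := by
    rcases (s ω).eq_empty_or_nonempty with h | ⟨i, hi⟩
    exacts [⟨0, .inr h⟩, ⟨i, .inl hi⟩]
  convert measurable_find hex fun i => (hs i).union hempty using 2 with ω
  rcases (s ω).eq_empty_or_nonempty with h | h
  · trans 0
    · rw [h, Nat.sInf_empty]
    · exact ((Nat.find_eq_zero _).2 (.inr h)).symm
  · rw [Nat.sInf_def h]
    simp [h.ne_empty]

variable [MetricSpace S] [SecondCountableTopology S] [Nonempty S]

/-- The least `i` such that, at infinitely many times in `A`, the sequence `u` is within `ε` of the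
`i`-th point of a dense sequence of `S`. -/
noncomputable def visitIndex (u : ℕ → S) (A : Set ℕ) (ε : ℝ) : ℕ :=
  sInf {i | ∃ᶠ n in atTop, n ∈ A ∧ dist (u n) (denseSeq S i) < ε}

/-- Nested sets of times: `u` stays in a single ball of radius `2⁻ᵏ`, the first one that it visits
infinitely often, at the times of `visitTimes u (k + 1)`. -/
noncomputable def visitTimes (u : ℕ → S) : ℕ → Set ℕ
  | 0 => univ
  | k + 1 => {n | n ∈ visitTimes u k ∧
      dist (u n) (denseSeq S (visitIndex u (visitTimes u k) ((1 / 2) ^ k))) < (1 / 2) ^ k}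

/-- The centre of the ball in which `u` stays at the times of `visitTimes u (k + 1)`. -/
noncomputable def visitCenter (u : ℕ → S) (k : ℕ) : S :=
  denseSeq S (visitIndex u (visitTimes u k) ((1 / 2) ^ k))

lemma mem_visitTimes_succ {u : ℕ → S} {k n : ℕ} : n ∈ visitTimes u (k + 1) ↔
    n ∈ visitTimes u k ∧ dist (u n) (visitCenter u k) < (1 / 2) ^ k :=
  Iff.rfl

lemma frequently_dist_denseSeq_visitIndex_lt {u : ℕ → S} {K : Set S} (hK : IsCompact K)
    (hu : ∀ᶠ n in atTop, u n ∈ K) {A : Set ℕ} (hA : ∃ᶠ n in atTop, n ∈ A) {ε : ℝ} (hε : 0 < ε) :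
    ∃ᶠ n in atTop, n ∈ A ∧ dist (u n) (denseSeq S (visitIndex u A ε)) < ε := by
  suffices h : {i | ∃ᶠ n in atTop, n ∈ A ∧ dist (u n) (denseSeq S i) < ε}.Nonempty from
    Nat.sInf_mem h
  have : (atTop ⊓ 𝓟 A).NeBot := frequently_mem_iff_neBot.1 hA
  have hle : map u (atTop ⊓ 𝓟 A) ≤ 𝓟 K := le_principal_iff.2 (mem_map.2 (mem_inf_of_left hu))
  obtain ⟨x, -, hx⟩ := hK hle
  obtain ⟨i, hi⟩ := (denseRange_denseSeq S).exists_dist_lt x hε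
  have hfreq : ∃ᶠ n in atTop ⊓ 𝓟 A, dist (u n) (denseSeq S i) < ε :=
    (show MapClusterPt x _ u from hx).frequently (Metric.isOpen_ball.mem_nhds hi)
  exact ⟨i, frequently_inf_principal.1 hfreq⟩

lemma frequently_mem_visitTimes {u : ℕ → S} {K : Set S} (hK : IsCompact K)
    (hu : ∀ᶠ n in atTop, u n ∈ K) (k : ℕ) : ∃ᶠ n in atTop, n ∈ visitTimes u k := by
  induction k with
  | zero => exact .of_forall fun _ => mem_univ _
  | succ k ih => exact frequently_dist_denseSeq_visitIndex_lt hK hu ih (by positivity)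

lemma cauchySeq_visitCenter {u : ℕ → S} {K : Set S} (hK : IsCompact K)
    (hu : ∀ᶠ n in atTop, u n ∈ K) : CauchySeq (visitCenter u) := by
  refine cauchySeq_of_le_geometric (1 / 2) 2 (by norm_num) fun k => ?_
  obtain ⟨n, hn⟩ := (frequently_mem_visitTimes hK hu (k + 2)).exists
  obtain ⟨hn', hk1⟩ := mem_visitTimes_succ.1 hn
  have hk := (mem_visitTimes_succ.1 hn').2
  have : (0 : ℝ) < (1 / 2) ^ k := by positivity
  rw [pow_succ] at hk1
  linarith [dist_triangle_left (visitCenter u k) (visitCenter u (k + 1)) (u n)]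

lemma mapClusterPt_of_tendsto_visitCenter {u : ℕ → S} {K : Set S} (hK : IsCompact K)
    (hu : ∀ᶠ n in atTop, u n ∈ K) {x : S} (hx : Tendsto (visitCenter u) atTop (𝓝 x)) :
    MapClusterPt x atTop u := by
  rw [Metric.nhds_basis_ball.mapClusterPt_iff_frequently]
  intro ε hε
  have hcenter : ∀ᶠ k in atTop, dist (visitCenter u k) x < ε / 2 :=
    Metric.tendsto_nhds.1 hx _ (half_pos hε)
  have hradius : ∀ᶠ k : ℕ in atTop, (1 / 2 : ℝ) ^ k < ε / 2 :=
    (tendsto_pow_atTop_nhds_zero_of_lt_one (by norm_num) (by norm_num)).eventually_lt_const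
      (half_pos hε)
  obtain ⟨k, hk, hk'⟩ := (hcenter.and hradius).exists
  refine (frequently_mem_visitTimes hK hu (k + 1)).mono fun n hn => ?_
  rw [Metric.mem_ball]
  linarith [(mem_visitTimes_succ.1 hn).2, dist_triangle (u n) (visitCenter u k) x]

variable [MeasurableSpace S] [BorelSpace S]

lemma measurable_visitIndex {f : ℕ → Ω → S} (hf : ∀ n, Measurable (f n)) {A : Ω → Set ℕ}
    (hA : ∀ n, MeasurableSet {ω | n ∈ A ω}) (ε : ℝ) :
    Measurable fun ω => visitIndex (fun n => f n ω) (A ω) ε :=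
  measurable_nat_sInf fun _ => measurableSet_frequently_atTop fun n =>
    (hA n).inter (measurableSet_lt ((hf n).dist measurable_const) measurable_const)

lemma measurableSet_mem_visitTimes {f : ℕ → Ω → S} (hf : ∀ n, Measurable (f n)) (k n : ℕ) :
    MeasurableSet {ω | n ∈ visitTimes (fun n => f n ω) k} := by
  induction k generalizing n with
  | zero => exact MeasurableSet.univ
  | succ k ih =>
    exact (ih n).inter (measurableSet_lt ((hf n).dist
      (measurable_from_top.comp (measurable_visitIndex hf ih _))) measurable_const)

lemma measurable_visitCenter {f : ℕ → Ω → S} (hf : ∀ n, Measurable (f n)) (k : ℕ) :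
    Measurable fun ω => visitCenter (fun n => f n ω) k :=
  measurable_from_top.comp (measurable_visitIndex hf (measurableSet_mem_visitTimes hf k) _)

theorem exists_aemeasurable_mapClusterPt [CompleteSpace S] {P : Measure Ω} {f : ℕ → Ω → S}
    (hf : ∀ n, AEMeasurable (f n) P)
    (hK : ∀ᵐ ω ∂P, ∃ K, IsCompact K ∧ ∀ᶠ n in atTop, f n ω ∈ K) :
    ∃ g : Ω → S, AEMeasurable g P ∧ ∀ᵐ ω ∂P, MapClusterPt (g ω) atTop fun n => f n ω := by
  have hmeas (k : ℕ) : AEMeasurable (fun ω => visitCenter (fun n => f n ω) k) P := by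
    refine ⟨_, measurable_visitCenter (fun n => (hf n).measurable_mk) k, ?_⟩
    filter_upwards [ae_all_iff.2 fun n => (hf n).ae_eq_mk] with ω hω
    simp only [hω]
  have hlim : ∀ᵐ ω ∂P, ∃ x, Tendsto (visitCenter fun n => f n ω) atTop (𝓝 x) := by
    filter_upwards [hK] with ω ⟨K, hK, hu⟩
    exact cauchySeq_tendsto_of_complete (cauchySeq_visitCenter hK hu)
  obtain ⟨g, hg, hgl⟩ := measurable_limit_of_tendsto_metrizable_ae hmeas hlim
  refine ⟨g, hg.aemeasurable, ?_⟩
  filter_upwards [hK, hgl] with ω ⟨K, hK, hu⟩ hgω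
  exact mapClusterPt_of_tendsto_visitCenter hK hu hgω

end ClusterPoint

/-! ### Hölder continuity of the paths of fractional Brownian motion -/

section Chaining

open Filter Topology

lemma natFloor_two_mul_eq_or {x : ℝ} (hx : 0 ≤ x) :
    ⌊2 * x⌋₊ = 2 * ⌊x⌋₊ ∨ ⌊2 * x⌋₊ = 2 * ⌊x⌋₊ + 1 := by
  have hle : 2 * ⌊x⌋₊ ≤ ⌊2 * x⌋₊ := Nat.le_floor (by push_cast; linarith [Nat.floor_le hx])
  have hlt : ⌊2 * x⌋₊ < 2 * ⌊x⌋₊ + 2 :=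
    (Nat.floor_lt (by positivity)).2 (by push_cast; linarith [Nat.lt_floor_add_one x])
  omega

lemma natFloor_mul_two_pow_le {t : ℝ} (ht : t ≤ 1) (n : ℕ) : ⌊t * 2 ^ n⌋₊ ≤ 2 ^ n :=
  Nat.floor_le_of_le (by push_cast; exact mul_le_of_le_one_left (by positivity) ht)

lemma tendsto_natFloor_mul_two_pow_div {t : ℝ} (ht : 0 ≤ t) :
    Tendsto (fun n : ℕ => (⌊t * 2 ^ n⌋₊ : ℝ) / 2 ^ n) atTop (𝓝 t) :=
  (tendsto_nat_floor_mul_div_atTop ht).comp (tendsto_pow_atTop_atTop_of_one_lt one_lt_two)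

variable {E : Type*} [PseudoMetricSpace E] {u : ℝ → E} {A a : ℝ}

lemma dist_natFloor_mul_two_pow_div_succ_le (hA : 0 ≤ A) (ha0 : 0 ≤ a) (ha1 : a ≤ 1)
    (hinc : ∀ n k : ℕ, k < 2 ^ n → dist (u (k / 2 ^ n)) (u ((k + 1 : ℕ) / 2 ^ n)) ≤ A * a ^ n)
    {t : ℝ} (ht : t ∈ Icc (0 : ℝ) 1) (n : ℕ) :
    dist (u (⌊t * 2 ^ n⌋₊ / 2 ^ n)) (u (⌊t * 2 ^ (n + 1)⌋₊ / 2 ^ (n + 1))) ≤ A * a ^ n := by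
  have hpt : (⌊t * 2 ^ n⌋₊ / 2 ^ n : ℝ) = (2 * ⌊t * 2 ^ n⌋₊ : ℕ) / 2 ^ (n + 1) := by
    rw [pow_succ']
    push_cast
    exact (mul_div_mul_left _ _ two_ne_zero).symm
  have hfloor := natFloor_two_mul_eq_or (mul_nonneg ht.1 (by positivity : (0 : ℝ) ≤ 2 ^ n))
  rw [show 2 * (t * 2 ^ n) = t * 2 ^ (n + 1) by ring] at hfloor
  have hle := natFloor_mul_two_pow_le ht.2 (n + 1)
  rw [hpt]
  rcases hfloor with h | h
  · rw [h, dist_self]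
    positivity
  · rw [h]
    exact (hinc _ _ (by omega)).trans
      (mul_le_mul_of_nonneg_left (pow_le_pow_of_le_one ha0 ha1 n.le_succ) hA)

lemma dist_natFloor_mul_two_pow_div_le (hu : ContinuousOn u (Icc 0 1)) (hA : 0 ≤ A) (ha0 : 0 ≤ a)
    (ha1 : a < 1)
    (hinc : ∀ n k : ℕ, k < 2 ^ n → dist (u (k / 2 ^ n)) (u ((k + 1 : ℕ) / 2 ^ n)) ≤ A * a ^ n)
    {t : ℝ} (ht : t ∈ Icc (0 : ℝ) 1) (n : ℕ) :
    dist (u (⌊t * 2 ^ n⌋₊ / 2 ^ n)) (u t) ≤ A * a ^ n / (1 - a) := by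
  have hmem (n : ℕ) : (⌊t * 2 ^ n⌋₊ / 2 ^ n : ℝ) ∈ Icc (0 : ℝ) 1 :=
    ⟨by positivity, div_le_one_of_le₀ (mod_cast natFloor_mul_two_pow_le ht.2 n) (by positivity)⟩
  have hlim : Tendsto (fun n : ℕ => u (⌊t * 2 ^ n⌋₊ / 2 ^ n)) atTop (𝓝 (u t)) :=
    (hu t ht).tendsto.comp (tendsto_nhdsWithin_iff.2
      ⟨tendsto_natFloor_mul_two_pow_div ht.1, .of_forall hmem⟩)
  exact dist_le_of_le_geometric_of_tendsto a A ha1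
    (dist_natFloor_mul_two_pow_div_succ_le hA ha0 ha1.le hinc ht) hlim n

lemma dist_natFloor_mul_two_pow_div_natFloor_le (hA : 0 ≤ A) (ha0 : 0 ≤ a)
    (hinc : ∀ n k : ℕ, k < 2 ^ n → dist (u (k / 2 ^ n)) (u ((k + 1 : ℕ) / 2 ^ n)) ≤ A * a ^ n)
    {s t : ℝ} (hs : 0 ≤ s) (hst : s ≤ t) (ht : t ≤ 1) {n : ℕ} (hn : t - s ≤ (1 / 2) ^ n) :
    dist (u (⌊s * 2 ^ n⌋₊ / 2 ^ n)) (u (⌊t * 2 ^ n⌋₊ / 2 ^ n)) ≤ A * a ^ n := by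
  have hle : ⌊s * 2 ^ n⌋₊ ≤ ⌊t * 2 ^ n⌋₊ := Nat.floor_le_floor (by gcongr)
  have hle' : ⌊t * 2 ^ n⌋₊ ≤ ⌊s * 2 ^ n⌋₊ + 1 := by
    rw [← Nat.floor_add_one (by positivity)]
    refine Nat.floor_le_floor ?_
    rw [one_div_pow, le_div_iff₀ (by positivity)] at hn
    linarith
  have htop := natFloor_mul_two_pow_le ht n
  rcases hle.eq_or_lt with h | h
  · rw [h, dist_self]
    positivity
  · rw [show ⌊t * 2 ^ n⌋₊ = ⌊s * 2 ^ n⌋₊ + 1 by omega]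
    exact hinc _ _ (by omega)

lemma exists_holderOnWith_of_dyadic (hu : ContinuousOn u (Icc 0 1)) (hA : 0 ≤ A) {γ : ℝ≥0}
    (hγ : 0 < γ) (hinc : ∀ n k : ℕ, k < 2 ^ n →
      dist (u (k / 2 ^ n)) (u ((k + 1 : ℕ) / 2 ^ n)) ≤ A * ((1 / 2 : ℝ) ^ (γ : ℝ)) ^ n) :
    ∃ C, HolderOnWith C γ u (Icc 0 1) := by
  set a : ℝ := (1 / 2) ^ (γ : ℝ) with ha
  have ha0 : 0 < a := by positivity
  have ha1 : a < 1 := Real.rpow_lt_one (by norm_num) (by norm_num) (mod_cast hγ)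
  have : 0 < 1 - a := sub_pos.2 ha1
  refine ⟨.mk ((A + 2 * (A / (1 - a))) / a) (by positivity), HolderWith.restrict_iff.1 <|
    holderWith_of_dist_le fun s t hst => ?_⟩
  rcases hst.eq_or_lt with rfl | hlt
  · simp [Real.zero_rpow (NNReal.coe_pos.2 hγ).ne']
  obtain ⟨n, hn, hn'⟩ := exists_nat_pow_near_of_lt_one (sub_pos.2 (Subtype.coe_lt_coe.2 hlt))
    (by linarith [s.2.1, t.2.2] : (t : ℝ) - s ≤ 1) (by norm_num : (0 : ℝ) < 1 / 2) (by norm_num)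
  have hpow : a ^ n ≤ ((t : ℝ) - s) ^ (γ : ℝ) / a := by
    rw [le_div_iff₀ ha0, ← pow_succ, ha, Real.rpow_pow_comm (by norm_num)]
    gcongr
  have hs := dist_natFloor_mul_two_pow_div_le hu hA ha0.le ha1 hinc s.2 n
  have ht := dist_natFloor_mul_two_pow_div_le hu hA ha0.le ha1 hinc t.2 n
  have hmid := dist_natFloor_mul_two_pow_div_natFloor_le hA ha0.le hinc s.2.1 hst t.2.2 hn'
  calc dist (u s) (u t)
      ≤ A * a ^ n / (1 - a) + A * a ^ n + A * a ^ n / (1 - a) :=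
        (dist_triangle4 _ _ _ _).trans (add_le_add_three (dist_comm _ (u s) ▸ hs) hmid ht)
    _ = (A + 2 * (A / (1 - a))) * a ^ n := by ring
    _ ≤ (A + 2 * (A / (1 - a))) * (((t : ℝ) - s) ^ (γ : ℝ) / a) := by gcongr
    _ = _ := by rw [NNReal.coe_mk]; ring

end Chaining

section Kolmogorov

variable {Ω E : Type*} [MeasurableSpace Ω] {P : Measure Ω} {p q : ℝ} {M : ℝ≥0}

lemma isAEKolmogorovProcess_comp_lipschitzWith {S T : Type*} [PseudoEMetricSpace S]
    [PseudoEMetricSpace T] [PseudoEMetricSpace E] {X : T → Ω → E}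
    (hX : IsAEKolmogorovProcess X P p q M) {K : ℝ≥0} {φ : S → T} (hφ : LipschitzWith K φ) :
    IsAEKolmogorovProcess (fun s => X (φ s)) P p q (M * K ^ q) := by
  obtain ⟨Y, hY, hXY⟩ := hX
  refine ⟨fun s => Y (φ s), ⟨fun s t => hY.measurablePair _ _, fun s t => ?_, hY.p_pos, hY.q_pos⟩,
    fun s => hXY _⟩
  calc ∫⁻ ω, edist (Y (φ s) ω) (Y (φ t) ω) ^ p ∂P
      ≤ M * edist (φ s) (φ t) ^ q := hY.kolmogorovCondition _ _
    _ ≤ M * (K * edist s t) ^ q := by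
        gcongr
        exacts [hY.q_pos.le, hφ s t]
    _ = (M * K ^ q : ℝ≥0) * edist s t ^ q := by
        rw [ENNReal.mul_rpow_of_nonneg _ _ hY.q_pos.le, ENNReal.coe_mul,
          ENNReal.coe_rpow_of_nonneg _ hY.q_pos.le, mul_assoc]

lemma lintegral_sum_dyadic_le [PseudoEMetricSpace E] {X : ℝ → Ω → E}
    (hX : IsAEKolmogorovProcess X P p q M) (γ : ℝ) (n : ℕ) :
    ∫⁻ ω, ∑ k ∈ Finset.range (2 ^ n), ((2 : ℝ≥0∞) ^ (γ * p)) ^ n *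
      edist (X (k / 2 ^ n) ω) (X ((k + 1 : ℕ) / 2 ^ n) ω) ^ p ∂P
        ≤ M * ((2 : ℝ≥0∞) ^ (1 + γ * p - q)) ^ n := by
  have hmeas (s t : ℝ) : AEMeasurable (fun ω => edist (X s ω) (X t ω) ^ p) P :=
    hX.aemeasurable_edist.pow_const p
  have hedist (k : ℕ) : edist ((k : ℝ) / 2 ^ n) ((k + 1 : ℕ) / 2 ^ n) = (2 ^ n)⁻¹ := by
    rw [edist_comm, edist_dist, Real.dist_eq, ← sub_div, Nat.cast_succ, add_sub_cancel_left,
      abs_of_pos (by positivity), one_div, ENNReal.ofReal_inv_of_pos (by positivity),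
      ENNReal.ofReal_pow zero_le_two, ENNReal.ofReal_ofNat]
  rw [lintegral_finsetSum' _ fun k _ => (hmeas _ _).const_mul _]
  calc ∑ k ∈ Finset.range (2 ^ n), ∫⁻ ω, ((2 : ℝ≥0∞) ^ (γ * p)) ^ n *
        edist (X (k / 2 ^ n) ω) (X ((k + 1 : ℕ) / 2 ^ n) ω) ^ p ∂P
      ≤ ∑ _k ∈ Finset.range (2 ^ n),
          ((2 : ℝ≥0∞) ^ (γ * p)) ^ n * (M * ((2 ^ n)⁻¹ : ℝ≥0∞) ^ q) := by
        refine Finset.sum_le_sum fun k _ => ?_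
        rw [lintegral_const_mul'' _ (hmeas _ _), ← hedist k]
        gcongr
        exact hX.kolmogorovCondition _ _
    _ = M * (2 ^ n * (((2 : ℝ≥0∞) ^ (γ * p)) ^ n * ((2 ^ n)⁻¹ : ℝ≥0∞) ^ q)) := by
        rw [Finset.sum_const, Finset.card_range, nsmul_eq_mul]
        push_cast
        ring
    _ = M * ((2 : ℝ≥0∞) ^ (1 + γ * p - q)) ^ n := by
        rw [ENNReal.inv_rpow, ← ENNReal.rpow_neg, ← ENNReal.rpow_natCast 2 n,
          ← ENNReal.rpow_mul, ← ENNReal.rpow_mul_natCast, ← ENNReal.rpow_mul_natCast,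
          ← ENNReal.rpow_add _ _ two_ne_zero ENNReal.ofNat_ne_top,
          ← ENNReal.rpow_add _ _ two_ne_zero ENNReal.ofNat_ne_top]
        congr 2
        ring

lemma lintegral_tsum_dyadic_lt_top [PseudoEMetricSpace E] {X : ℝ → Ω → E}
    (hX : IsAEKolmogorovProcess X P p q M) {γ : ℝ} (hγ : γ * p < q - 1) :
    ∫⁻ ω, ∑' n : ℕ, ∑ k ∈ Finset.range (2 ^ n), ((2 : ℝ≥0∞) ^ (γ * p)) ^ n *
      edist (X (k / 2 ^ n) ω) (X ((k + 1 : ℕ) / 2 ^ n) ω) ^ p ∂P < ∞ := by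
  rw [lintegral_tsum fun n => Finset.aemeasurable_fun_sum _ fun k _ =>
    (hX.aemeasurable_edist.pow_const p).const_mul _]
  refine (ENNReal.tsum_le_tsum (lintegral_sum_dyadic_le hX γ)).trans_lt ?_
  rw [ENNReal.tsum_mul_left, ENNReal.tsum_geometric]
  refine ENNReal.mul_lt_top ENNReal.coe_lt_top (ENNReal.inv_lt_top.2 (tsub_pos_of_lt ?_))
  exact ENNReal.rpow_lt_one_of_one_lt_of_neg (by norm_num) (by linarith)

variable [PseudoMetricSpace E]

lemma ae_exists_forall_dist_dyadic_le {X : ℝ → Ω → E} (hX : IsAEKolmogorovProcess X P p q M)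
    {γ : ℝ} (hγ : γ * p < q - 1) :
    ∀ᵐ ω ∂P, ∃ A : ℝ, 0 ≤ A ∧ ∀ n k : ℕ, k < 2 ^ n →
      dist (X (k / 2 ^ n) ω) (X ((k + 1 : ℕ) / 2 ^ n) ω) ≤ A * ((1 / 2 : ℝ) ^ γ) ^ n := by
  have hmeas : AEMeasurable (fun ω => ∑' n : ℕ, ∑ k ∈ Finset.range (2 ^ n),
      ((2 : ℝ≥0∞) ^ (γ * p)) ^ n * edist (X (k / 2 ^ n) ω) (X ((k + 1 : ℕ) / 2 ^ n) ω) ^ p) P :=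
    AEMeasurable.tsum fun n => Finset.aemeasurable_fun_sum _ fun k _ =>
      (hX.aemeasurable_edist.pow_const p).const_mul _
  filter_upwards [ae_lt_top' hmeas (lintegral_tsum_dyadic_lt_top hX hγ).ne] with ω hω
  set Q := ∑' n : ℕ, ∑ k ∈ Finset.range (2 ^ n),
    ((2 : ℝ≥0∞) ^ (γ * p)) ^ n * edist (X (k / 2 ^ n) ω) (X ((k + 1 : ℕ) / 2 ^ n) ω) ^ p
  have hp := hX.p_pos
  have hQ : Q ^ p⁻¹ ≠ ∞ := (ENNReal.rpow_lt_top_of_nonneg (inv_nonneg.2 hp.le) hω.ne).ne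
  refine ⟨(Q ^ p⁻¹).toReal, ENNReal.toReal_nonneg, fun n k hk => ?_⟩
  have hle : (((2 : ℝ≥0∞) ^ γ) ^ n * edist (X (k / 2 ^ n) ω) (X ((k + 1 : ℕ) / 2 ^ n) ω)) ^ p
      ≤ Q := by
    rw [ENNReal.mul_rpow_of_nonneg _ _ hp.le, ← ENNReal.rpow_mul_natCast, ← ENNReal.rpow_mul,
      mul_right_comm, ENNReal.rpow_mul_natCast]
    exact (Finset.single_le_sum (f := fun k : ℕ => ((2 : ℝ≥0∞) ^ (γ * p)) ^ n *
      edist (X (k / 2 ^ n) ω) (X ((k + 1 : ℕ) / 2 ^ n) ω) ^ p) (fun _ _ => zero_le)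
      (Finset.mem_range.2 hk)).trans (ENNReal.le_tsum n)
  have hreal := ENNReal.toReal_mono hQ ((ENNReal.le_rpow_inv_iff hp).2 hle)
  rw [ENNReal.toReal_mul, ENNReal.toReal_pow, ← ENNReal.toReal_rpow, ← dist_edist,
    ENNReal.toReal_ofNat, ← le_div_iff₀' (by positivity)] at hreal
  rwa [one_div, Real.inv_rpow zero_le_two, inv_pow, ← div_eq_mul_inv]

theorem ae_exists_holderOnWith_of_isAEKolmogorovProcess {X : ℝ → Ω → E}
    (hX : IsAEKolmogorovProcess X P p q M) {T : ℝ} (hT : 0 < T)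
    (hcont : ∀ᵐ ω ∂P, ContinuousOn (fun t => X t ω) (Icc 0 T)) {γ : ℝ≥0} (hγ : 0 < γ)
    (hγq : γ * p < q - 1) :
    ∀ᵐ ω ∂P, ∃ C, HolderOnWith C γ (fun t => X t ω) (Icc 0 T) := by
  have hscale : LipschitzWith T.toNNReal fun t => T * t := by
    simpa [Real.nnnorm_of_nonneg hT.le, Real.toNNReal_of_nonneg hT.le] using
      (lipschitzWith_smul T : LipschitzWith ‖T‖₊ fun t : ℝ => T • t)
  have hmaps : MapsTo (T⁻¹ * ·) (Icc 0 T) (Icc 0 1) := fun t ht =>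
    ⟨mul_nonneg (inv_nonneg.2 hT.le) ht.1, (inv_mul_le_one₀ hT).2 ht.2⟩
  filter_upwards [hcont, ae_exists_forall_dist_dyadic_le
    (isAEKolmogorovProcess_comp_lipschitzWith hX hscale) hγq] with ω hω ⟨A, hA, hinc⟩
  obtain ⟨C, hC⟩ := exists_holderOnWith_of_dyadic (u := fun t => X (T * t) ω)
    (hω.comp (by fun_prop) fun t ht =>
      ⟨mul_nonneg hT.le ht.1, mul_le_of_le_one_right hT.le ht.2⟩) hA hγ hinc
  have hinv : LipschitzWith ‖T⁻¹‖₊ fun t : ℝ => T⁻¹ * t := lipschitzWith_smul T⁻¹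
  have hcomp := hC.comp ((holderWith_one.2 hinv).holderOnWith _) hmaps
  simp only [mul_one, Function.comp_def, mul_inv_cancel_left₀ hT.ne'] at hcomp
  exact ⟨_, hcomp⟩

end Kolmogorov

section FractionalBrownianMotion

variable {Ω : Type*} [MeasurableSpace Ω] {P : Measure Ω} {p : ℝ}

lemma lintegral_enorm_rpow_gaussianReal_lt_top (μ : ℝ) (v : ℝ≥0) (hp : 0 < p) :
    ∫⁻ x, ‖x‖ₑ ^ p ∂gaussianReal μ v < ∞ := by
  have h := memLp_id_gaussianReal' (μ := μ) (v := v) (ENNReal.ofReal p) ENNReal.ofReal_ne_top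
  simpa [ENNReal.toReal_ofReal hp.le] using lintegral_rpow_enorm_lt_top_of_eLpNorm_lt_top
    (by simpa using hp) ENNReal.ofReal_ne_top h.2

lemma lintegral_enorm_rpow_gaussianReal (c : ℝ≥0) (hp : 0 ≤ p) :
    ∫⁻ x, ‖x‖ₑ ^ p ∂gaussianReal 0 (c ^ 2) = c ^ p * ∫⁻ x, ‖x‖ₑ ^ p ∂gaussianReal 0 1 := by
  have hmeas : Measurable fun x : ℝ => ‖x‖ₑ ^ p := by fun_prop
  have hmap : gaussianReal 0 (c ^ 2) = (gaussianReal 0 1).map ((c : ℝ) * ·) := by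
    rw [gaussianReal_map_const_mul, mul_zero, mul_one]
    rfl
  rw [hmap, lintegral_map hmeas (measurable_const_mul _), ← lintegral_const_mul _ hmeas]
  refine lintegral_congr fun x => ?_
  rw [enorm_mul, ENNReal.mul_rpow_of_nonneg _ _ hp, Real.enorm_of_nonneg c.coe_nonneg,
    ENNReal.ofReal_coe_nnreal]

variable {H : ℝ} {B : ℝ≥0 → Ω → ℝ}

namespace IsFractionalBrownianMotion

lemma variance_sub (hB : IsFractionalBrownianMotion H B P) (hH : H ≠ 0) (s t : ℝ≥0) :
    Var[fun ω => B s ω - B t ω; P] = dist s t ^ (2 * H) := by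
  have := hB.gaussian.isProbabilityMeasure
  have hvar (t) : Var[B t; P] = (t : ℝ) ^ (2 * H) := by
    rw [← covariance_self (hB.gaussian.aemeasurable t), hB.covariance_eq, sub_self, abs_zero,
      Real.zero_rpow (mul_ne_zero two_ne_zero hH)]
    ring
  rw [variance_fun_sub (hB.gaussian.hasGaussianLaw_eval s).memLp_two
    (hB.gaussian.hasGaussianLaw_eval t).memLp_two, hvar, hvar, hB.covariance_eq, NNReal.dist_eq,
    abs_sub_comm (t : ℝ)]
  ring

lemma map_sub_eq_gaussianReal (hB : IsFractionalBrownianMotion H B P) (hH : H ≠ 0) (s t : ℝ≥0) :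
    P.map (fun ω => B s ω - B t ω) = gaussianReal 0 ((nndist s t ^ H) ^ 2) := by
  have hmean : ∫ ω, B s ω - B t ω ∂P = 0 := by
    rw [integral_sub (hB.gaussian.hasGaussianLaw_eval s).integrable
      (hB.gaussian.hasGaussianLaw_eval t).integrable, hB.centered, hB.centered, sub_zero]
  rw [(hB.gaussian.hasGaussianLaw_fun_sub (s := s) (t := t)).map_eq_gaussianReal, hmean,
    hB.variance_sub hH]
  congr 1
  rw [← NNReal.coe_inj, Real.coe_toNNReal _ (by positivity), NNReal.coe_pow, NNReal.coe_rpow,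
    coe_nndist, ← Real.rpow_mul_natCast dist_nonneg, mul_comm H]
  norm_cast

lemma isAEKolmogorovProcess (hB : IsFractionalBrownianMotion H B P) (hH : 0 < H) (hp : 0 < p) :
    IsAEKolmogorovProcess B P p (H * p)
      (∫⁻ x, ‖x‖ₑ ^ p ∂gaussianReal 0 1).toNNReal := by
  have hmeas := hB.gaussian.aemeasurable
  refine ⟨fun t => (hmeas t).mk, .mk_of_secondCountableTopology
    (fun t => (hmeas t).measurable_mk) (fun s t => le_of_eq ?_) hp (by positivity),
    fun t => (hmeas t).ae_eq_mk⟩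
  calc ∫⁻ ω, edist ((hmeas s).mk _ ω) ((hmeas t).mk _ ω) ^ p ∂P
      = ∫⁻ ω, ‖B s ω - B t ω‖ₑ ^ p ∂P := by
        refine lintegral_congr_ae ?_
        filter_upwards [(hmeas s).ae_eq_mk, (hmeas t).ae_eq_mk] with ω hs ht
        rw [← hs, ← ht, edist_eq_enorm_sub]
    _ = ∫⁻ x, ‖x‖ₑ ^ p ∂P.map (fun ω => B s ω - B t ω) :=
        (lintegral_map' (f := fun x : ℝ => ‖x‖ₑ ^ p) (by fun_prop)
          ((hmeas s).sub (hmeas t))).symm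
    _ = (∫⁻ x, ‖x‖ₑ ^ p ∂gaussianReal 0 1).toNNReal * edist s t ^ (H * p) := by
        rw [hB.map_sub_eq_gaussianReal hH.ne', lintegral_enorm_rpow_gaussianReal _ hp.le,
          ENNReal.coe_toNNReal (lintegral_enorm_rpow_gaussianReal_lt_top 0 1 hp).ne, mul_comm,
          ENNReal.coe_rpow_of_nonneg _ hH.le, ENNReal.rpow_mul, edist_nndist]

lemma ae_exists_holderOnWith (hB : IsFractionalBrownianMotion H B P) {γ : ℝ≥0} (hγ : 0 < γ)
    (hγH : γ < H) {T : ℝ} (hT : 0 < T) :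
    ∀ᵐ ω ∂P, ∃ C, HolderOnWith C γ (fun t : ℝ => B t.toNNReal ω) (Icc 0 T) := by
  have hgap : 0 < H - γ := sub_pos.2 hγH
  have hH : 0 < H := (NNReal.coe_pos.2 hγ).trans hγH
  have hkol := isAEKolmogorovProcess_comp_lipschitzWith
    (hB.isAEKolmogorovProcess hH (by positivity : 0 < 2 / (H - γ))) Real.lipschitzWith_toNNReal
  refine ae_exists_holderOnWith_of_isAEKolmogorovProcess hkol hT ?_ hγ ?_
  · filter_upwards [hB.continuous_paths] with ω hω
    exact (hω.comp continuous_real_toNNReal).continuousOn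
  · have : (H - γ) * (2 / (H - γ)) = 2 := mul_div_cancel₀ 2 hgap.ne'
    linarith

end IsFractionalBrownianMotion

theorem ae_exists_holderOnWith_drivingPath {m : ℕ} {W : Fin m → ℝ≥0 → Ω → ℝ}
    (hW : ∀ j, IsFractionalBrownianMotion H (W j) P) {γ : ℝ≥0} (hγ : 0 < γ) (hγH : γ < H) {T : ℝ}
    (hT : 0 < T) : ∀ᵐ ω ∂P, ∃ C, HolderOnWith C γ (drivingPath W ω) (Icc 0 T) := by
  filter_upwards [ae_all_iff.2 fun j => (hW j).ae_exists_holderOnWith hγ hγH hT] with ω hω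
  choose C hC using hω
  refine ⟨NNReal.sqrt m * ∑ j, C j,
    HolderWith.restrict_iff.1 <| holderWith_of_dist_le fun s t hst => ?_⟩
  rw [NNReal.coe_mul, Real.coe_sqrt, NNReal.coe_natCast, mul_assoc, dist_eq_norm]
  have hts : (0 : ℝ) ≤ t - s := sub_nonneg.2 (Subtype.coe_le_coe.2 hst)
  have hbound (j : Fin m) : |(drivingPath W ω s - drivingPath W ω t) j|
      ≤ (∑ j, C j : ℝ≥0) * ((t : ℝ) - s) ^ (γ : ℝ) := by
    have h := (hC j).dist_le s.2 t.2
    rw [Real.dist_eq, dist_comm, Real.dist_eq, abs_of_nonneg hts] at h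
    refine h.trans (mul_le_mul_of_nonneg_right ?_ (Real.rpow_nonneg hts _))
    exact_mod_cast Finset.single_le_sum_of_canonicallyOrdered (Finset.mem_univ j)
  simpa using norm_le_sqrt_card_mul (by positivity) hbound

lemma aemeasurable_drivingPath {m : ℕ} {W : Fin m → ℝ≥0 → Ω → ℝ}
    (hW : ∀ j, IsFractionalBrownianMotion H (W j) P) (t : ℝ) :
    AEMeasurable (fun ω => drivingPath W ω t) P :=
  (WithLp.measurable_toLp 2 _).comp_aemeasurable
    (aemeasurable_pi_lambda _ fun j => (hW j).gaussian.aemeasurable _)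

end FractionalBrownianMotion

lemma isCompact_setOf_holderWith_apply_eq {X E : Type*} [PseudoMetricSpace X] [MetricSpace E]
    [ProperSpace E] (C : ℝ≥0) {γ : ℝ≥0} (hγ : 0 < γ) (a : X) (c : E) :
    IsCompact {f : C(X, E) | HolderWith C γ f ∧ f a = c} := by
  refine ArzelaAscoli.isCompact_of_equicontinuous _ ?_ ?_
  · have himage : ContinuousMap.toFun '' {f : C(X, E) | HolderWith C γ f ∧ f a = c} =
        {φ : X → E | HolderWith C γ φ ∧ φ a = c} := by
      ext φ
      refine ⟨?_, fun hφ => ⟨⟨φ, hφ.1.continuous hγ⟩, hφ, rfl⟩⟩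
      rintro ⟨f, hf, rfl⟩
      exact hf
    rw [himage]
    refine (isCompact_univ_pi fun x => isCompact_closedBall c (C * dist x a ^ (γ : ℝ)))
      |>.of_isClosed_subset
      ((isClosed_setOf_holderWith C γ).inter
        (isClosed_eq (continuous_apply a) continuous_const)) fun φ hφ x _ => ?_
    simpa only [Metric.mem_closedBall, hφ.2] using hφ.1.dist_le x a
  · refine (Metric.uniformEquicontinuous_of_continuity_modulus (fun δ => C * δ ^ (γ : ℝ)) ?_ _
      fun x y f => f.2.1.dist_le x y).equicontinuous
    have hcont : Continuous fun δ : ℝ => C * δ ^ (γ : ℝ) :=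
      continuous_const.mul (continuous_id.rpow_const fun _ => Or.inr γ.coe_nonneg)
    simpa [Real.zero_rpow (NNReal.coe_pos.2 hγ).ne'] using hcont.tendsto 0

section Coefficients

lemma aestronglyMeasurable_comp_of_ae_continuous {α X E : Type*} [MeasurableSpace α]
    [TopologicalSpace X] [TopologicalSpace E] [TopologicalSpace.PseudoMetrizableSpace E]
    [AddCommMonoid E] [ContinuousAdd E] {μ : Measure α} {F : α → X → E}
    (hF : ∀ x, AEStronglyMeasurable (fun a => F a x) μ) (hFc : ∀ᵐ a ∂μ, Continuous (F a))
    {g : α → X} (hg : StronglyMeasurable g) : AEStronglyMeasurable (fun a => F a (g a)) μ := by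
  refine aestronglyMeasurable_of_tendsto_ae Filter.atTop (f := fun n a => F a (hg.approx n a))
    (fun n => ?_) (hFc.mono fun a ha => (ha.tendsto _).comp (hg.tendsto_approx a))
  have hsum : (fun a => F a (hg.approx n a)) = fun a => ∑ x ∈ (hg.approx n).range,
      (hg.approx n ⁻¹' {x}).indicator (fun a => F a x) a := by
    funext a
    rw [Finset.sum_eq_single_of_mem _ (SimpleFunc.mem_range_self _ a) fun x _ hx =>
      indicator_of_notMem (fun hmem => hx hmem.symm) _, indicator_of_mem (by simp)]
  rw [hsum]
  exact Finset.aestronglyMeasurable_fun_sum _ fun x _ =>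
    (hF x).indicator ((hg.approx n).measurableSet_fiber x)

variable {U V : Type*} [NormedAddCommGroup U] [NormedSpace ℝ U] [NormedAddCommGroup V]
  [NormedSpace ℝ V]

/-- The uniform bounds and moduli of continuity of a drift `b` and a diffusion coefficient `f` on
which all estimates depend. -/
structure CoefficientBounds (T γ : ℝ) (M K : ℝ≥0) (b : ℝ → V → V) (f : ℝ → V → U →L[ℝ] V) :
    Prop where
  drift_measurable : ∀ x, AEStronglyMeasurable (fun t => b t x) (volume.restrict (Icc 0 T))
  drift_le : ∀ t ∈ Icc 0 T, ∀ x, ‖b t x‖ ≤ M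
  drift_lipschitz : ∀ t ∈ Icc 0 T, LipschitzWith K (b t)
  coeff_le : ∀ t ∈ Icc 0 T, ∀ x, ‖f t x‖ ≤ M
  coeff_sub_le : ∀ s ∈ Icc 0 T, ∀ t ∈ Icc 0 T, ∀ x y,
    ‖f t y - f s x‖ ≤ K * (|t - s| ^ γ + ‖y - x‖)

namespace CoefficientBounds

variable {T γ : ℝ} {M K : ℝ≥0} {b : ℝ → V → V} {f : ℝ → V → U →L[ℝ] V}

lemma continuous_coeff (h : CoefficientBounds T γ M K b f) (hγ : 0 < γ) :
    Continuous fun p : Icc 0 T × V => f p.1 p.2 := by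
  refine continuous_iff_continuousAt.2 fun p => tendsto_iff_norm_sub_tendsto_zero.2 ?_
  refine squeeze_zero (fun _ => norm_nonneg _)
    (fun q => h.coeff_sub_le p.1 p.1.2 q.1 q.1.2 p.2 q.2) ?_
  have hcont : Continuous fun q : Icc 0 T × V =>
      K * (|(q.1 : ℝ) - p.1| ^ γ + ‖q.2 - p.2‖) := by
    have : Continuous fun q : Icc 0 T × V => |(q.1 : ℝ) - p.1| ^ γ :=
      Continuous.rpow_const (by fun_prop) fun _ => Or.inr hγ.le
    fun_prop
  simpa [Real.zero_rpow hγ.ne'] using hcont.tendsto p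

lemma intervalIntegrable_drift (h : CoefficientBounds T γ M K b f) {x : ℝ → V}
    (hx : StronglyMeasurable x) {s t : ℝ} (hs : s ∈ Icc 0 T) (ht : t ∈ Icc 0 T) :
    IntervalIntegrable (fun u => b u (x u)) volume s t := by
  have hT : 0 ≤ T := hs.1.trans hs.2
  have hmeas : AEStronglyMeasurable (fun u => b u (x u)) (volume.restrict (Icc 0 T)) :=
    aestronglyMeasurable_comp_of_ae_continuous h.drift_measurable
      ((ae_restrict_mem measurableSet_Icc).mono fun u hu => (h.drift_lipschitz u hu).continuous) hx
  have hint : IntegrableOn (fun u => b u (x u)) (uIcc 0 T) := by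
    rw [uIcc_of_le hT]
    exact Integrable.of_bound hmeas M
      ((ae_restrict_mem measurableSet_Icc).mono fun u hu => h.drift_le u hu _)
  exact hint.intervalIntegrable.mono_set
    (uIcc_subset_uIcc (by rwa [uIcc_of_le hT]) (by rwa [uIcc_of_le hT]))

lemma norm_integral_drift_le (h : CoefficientBounds T γ M K b f) (x : ℝ → V) {s t : ℝ}
    (hs : s ∈ Icc 0 T) (ht : t ∈ Icc 0 T) : ‖∫ u in s..t, b u (x u)‖ ≤ M * |t - s| :=
  intervalIntegral.norm_integral_le_of_norm_le_const fun u hu =>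
    h.drift_le u (uIcc_subset_Icc hs ht (uIoc_subset_uIcc hu)) _

lemma norm_integral_drift_sub_le (h : CoefficientBounds T γ M K b f) {x y : ℝ → V}
    (hx : StronglyMeasurable x) (hy : StronglyMeasurable y) {s t B : ℝ} (hs : s ∈ Icc 0 T)
    (ht : t ∈ Icc 0 T) (hB : ∀ u ∈ uIcc s t, ‖x u - y u‖ ≤ B) :
    ‖(∫ u in s..t, b u (x u)) - ∫ u in s..t, b u (y u)‖ ≤ K * B * |t - s| := by
  rw [← intervalIntegral.integral_sub (h.intervalIntegrable_drift hx hs ht)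
    (h.intervalIntegrable_drift hy hs ht)]
  refine intervalIntegral.norm_integral_le_of_norm_le_const fun u hu => ?_
  have hu' := uIoc_subset_uIcc hu
  exact ((h.drift_lipschitz u (uIcc_subset_Icc hs ht hu')).norm_sub_le _ _).trans
    (mul_le_mul_of_nonneg_left (hB u hu') K.coe_nonneg)

lemma continuous_integral_drift_const (h : CoefficientBounds T γ M K b f) {s t : ℝ}
    (hs : s ∈ Icc 0 T) (ht : t ∈ Icc 0 T) : Continuous fun x => ∫ u in s..t, b u x :=
  (LipschitzWith.of_dist_le_mul (K := K * Real.nnabs (t - s)) fun x y => by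
    simpa [dist_eq_norm, mul_right_comm] using h.norm_integral_drift_sub_le
      (stronglyMeasurable_const (b := x)) (stronglyMeasurable_const (b := y)) hs ht
      fun _ _ => le_rfl).continuous

end CoefficientBounds

/-- The drift term `∫₀ᵗ b(u, x(u)) du` of the equation as a functional of the path `x`. -/
noncomputable def driftIntegral {T : ℝ} (hT : 0 ≤ T) (b : ℝ → V → V) (x : C(Icc 0 T, V)) (t : ℝ) :
    V :=
  ∫ u in (0 : ℝ)..t, b u (IccExtend hT x u)

namespace CoefficientBounds

variable {T γ : ℝ} {M K : ℝ≥0} {b : ℝ → V → V} {f : ℝ → V → U →L[ℝ] V}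

lemma driftIntegral_sub (h : CoefficientBounds T γ M K b f) (hT : 0 ≤ T) (x : C(Icc 0 T, V))
    {s t : ℝ} (hs : s ∈ Icc 0 T) (ht : t ∈ Icc 0 T) :
    driftIntegral hT b x t - driftIntegral hT b x s = ∫ u in s..t, b u (IccExtend hT x u) :=
  have hx := x.continuous.Icc_extend'.stronglyMeasurable
  intervalIntegral.integral_interval_sub_left
    (h.intervalIntegrable_drift hx (left_mem_Icc.2 hT) ht)
    (h.intervalIntegrable_drift hx (left_mem_Icc.2 hT) hs)

lemma continuous_driftIntegral (h : CoefficientBounds T γ M K b f) (hT : 0 ≤ T) :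
    Continuous fun p : C(Icc 0 T, V) × Icc 0 T => driftIntegral hT b p.1 p.2 := by
  refine (LipschitzWith.uncurry (f := fun x (t : Icc 0 T) => driftIntegral hT b x t)
    (Kα := K * T.toNNReal) (Kβ := M) (fun t => ?_) fun x => ?_).continuous
  · refine LipschitzWith.of_dist_le_mul fun x y => ?_
    rw [dist_eq_norm]
    refine (h.norm_integral_drift_sub_le x.continuous.Icc_extend'.stronglyMeasurable
      y.continuous.Icc_extend'.stronglyMeasurable (left_mem_Icc.2 hT) t.2
      fun u _ => (dist_eq_norm _ _).symm.trans_le (x.dist_apply_le_dist _)).trans ?_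
    rw [sub_zero, abs_of_nonneg t.2.1, mul_right_comm, NNReal.coe_mul, Real.coe_toNNReal _ hT]
    gcongr
    exact t.2.2
  · refine LipschitzWith.of_dist_le_mul fun t s => ?_
    rw [dist_eq_norm, h.driftIntegral_sub hT x s.2 t.2, Subtype.dist_eq, Real.dist_eq]
    exact h.norm_integral_drift_le _ s.2 t.2

end CoefficientBounds

section Matrix

open scoped Matrix.Norms.Frobenius

variable {d m : ℕ}

/-- The continuous linear map between Euclidean spaces with a given matrix. -/
noncomputable def matrixCLM (A : Matrix (Fin d) (Fin m) ℝ) :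
    EuclideanSpace ℝ (Fin m) →L[ℝ] EuclideanSpace ℝ (Fin d) :=
  LinearMap.toContinuousLinearMap (Matrix.toEuclideanLin A)

lemma matrixCLM_sub (A B : Matrix (Fin d) (Fin m) ℝ) :
    matrixCLM (A - B) = matrixCLM A - matrixCLM B := by
  simp [matrixCLM]

lemma norm_matrixCLM_le (A : Matrix (Fin d) (Fin m) ℝ) : ‖matrixCLM A‖ ≤ ‖A‖ := by
  refine ContinuousLinearMap.opNorm_le_bound _ (norm_nonneg _) fun v => ?_
  have hmul := Matrix.frobenius_norm_mul A (Matrix.replicateCol (Fin 1) v.ofLp)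
  have hcol (k : ℕ) (u : Fin k → ℝ) : ‖Matrix.replicateCol (Fin 1) u‖ = ‖WithLp.toLp 2 u‖ :=
    Matrix.frobenius_norm_replicateCol u
  rwa [← Matrix.replicateCol_mulVec, hcol, hcol] at hmul

lemma continuous_matrixCLM : Continuous (matrixCLM (d := d) (m := m)) :=
  (LipschitzWith.of_dist_le_mul (K := 1) fun A B => by
    simpa [dist_eq_norm, matrixCLM_sub] using norm_matrixCLM_le (A - B)).continuous

lemma DiffusionHypothesis.exists_norm_sub_le {T γ ν : ℝ}
    {σ : ℝ → EuclideanSpace ℝ (Fin d) → Matrix (Fin d) (Fin m) ℝ} (hσ : DiffusionHypothesis T ν σ)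
    (hγ : 0 < γ) (hγν : γ ≤ ν) : ∃ K : ℝ≥0, ∀ s ∈ Icc 0 T, ∀ t ∈ Icc 0 T, ∀ x y,
      ‖σ t y - σ s x‖ ≤ K * (|t - s| ^ γ + ‖y - x‖) := by
  obtain ⟨K₀, hx, ht⟩ := hσ.regular
  refine ⟨Real.nnabs K₀ * max 1 (T ^ (ν - γ)).toNNReal, fun s hs t ht' x y => ?_⟩
  have hpow : |t - s| ^ ν ≤ T ^ (ν - γ) * |t - s| ^ γ := by
    rw [← sub_add_cancel ν γ, Real.rpow_add_of_nonneg (abs_nonneg _) (sub_nonneg.2 hγν) hγ.le,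
      sub_add_cancel]
    gcongr
    simpa only [sub_zero] using abs_sub_le_of_le_of_le ht'.1 ht'.2 hs.1 hs.2
  calc ‖σ t y - σ s x‖ ≤ ‖σ t y - σ s y‖ + ‖σ s y - σ s x‖ := norm_sub_le_norm_sub_add_norm_sub ..
    _ ≤ |K₀| * |t - s| ^ ν + |K₀| * ‖y - x‖ := add_le_add
        ((ht y t ht' s hs).trans (by gcongr; exact le_abs_self _))
        ((hx s hs y x).trans (by gcongr; exact le_abs_self _))
    _ ≤ |K₀| * (max 1 (T ^ (ν - γ)) * |t - s| ^ γ) + |K₀| * (max 1 (T ^ (ν - γ)) * ‖y - x‖) := by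
        gcongr
        · exact hpow.trans (by gcongr; exact le_max_right _ _)
        · exact le_mul_of_one_le_left (norm_nonneg _) (le_max_left _ _)
    _ ≤ _ := by
        rw [← mul_add, ← mul_add, ← mul_assoc, NNReal.coe_mul, NNReal.coe_max, NNReal.coe_one,
          Real.coe_nnabs]
        gcongr
        exact Real.le_coe_toNNReal _

lemma exists_coefficientBounds {T γ ν : ℝ} (hγ : 0 < γ) (hγν : γ ≤ ν)
    {b : ℝ → EuclideanSpace ℝ (Fin d) → EuclideanSpace ℝ (Fin d)}
    {σ : ℝ → EuclideanSpace ℝ (Fin d) → Matrix (Fin d) (Fin m) ℝ}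
    (hb : DriftHypothesis T b) (hσ : DiffusionHypothesis T ν σ) :
    ∃ M K, CoefficientBounds T γ M K b fun t x => matrixCLM (σ t x) := by
  obtain ⟨M₁, hM₁⟩ := hb.bounded
  obtain ⟨M₂, hM₂⟩ := hσ.bounded
  obtain ⟨K₁, hK₁⟩ := hb.lipschitz
  obtain ⟨K₂, hK₂⟩ := hσ.exists_norm_sub_le hγ hγν
  have hLip (t : ℝ) (ht : t ∈ Icc 0 T) : LipschitzWith K₁.toNNReal (b t) :=
    LipschitzWith.of_dist_le' fun x y => by simpa only [dist_eq_norm] using hK₁ t ht x y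
  refine ⟨max M₁.toNNReal M₂.toNNReal, max K₁.toNNReal K₂,
    hb.measurable, fun t ht x => (hM₁ t ht x).trans ?_,
    fun t ht => (hLip t ht).weaken (le_max_left _ _),
    fun t ht x => (norm_matrixCLM_le _).trans ((hM₂ t ht x).trans ?_), fun s hs t ht x y => ?_⟩
  · exact (Real.le_coe_toNNReal _).trans (NNReal.coe_le_coe.2 (le_max_left _ _))
  · exact (Real.le_coe_toNNReal _).trans (NNReal.coe_le_coe.2 (le_max_right _ _))
  · rw [← matrixCLM_sub]
    refine (norm_matrixCLM_le _).trans ((hK₂ s hs t ht x y).trans ?_)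
    gcongr
    exact le_max_right _ _

end Matrix

end Coefficients

lemma isRegulator_of_succ {z y : ℕ → ℝ} (h0 : y 0 = (z 0)⁻)
    (hsucc : ∀ k, y (k + 1) = max (z (k + 1))⁻ (y k)) : IsRegulator z y := fun k => by
  induction k with
  | zero =>
    rw [show Iic 0 = {0} from Iic_bot, image_singleton, h0]
    exact isGreatest_singleton
  | succ k ih =>
    rw [← Nat.succ_eq_add_one, ← Nat.succ_eq_succ, Order.Iic_succ, image_insert_eq,
      Nat.succ_eq_succ, Nat.succ_eq_add_one, hsucc]
    exact ih.insert _

lemma IsGridSolution.norm_sub_sub_sub_le {U V : Type*} [NormedAddCommGroup U] [NormedSpace ℝ U]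
    [NormedAddCommGroup V] [NormedSpace ℝ V] {M K G γ h B : ℝ} {N : ℕ} {z : ℕ → V}
    {f : ℕ → U →L[ℝ] V} {w : ℕ → U} {β : ℕ → V} (hz : IsGridSolution M K G γ h N z f w β)
    (hh : 0 ≤ h) (hK : 0 ≤ K) (hG : 0 ≤ G) (hγ : 1 / 2 < γ) (hB : 0 ≤ B)
    (hzB : GridHolderOn B γ h z 0 N) {k l : ℕ} (hkl : k ≤ l) (hl : l ≤ N) :
    ‖z l - z k - ∑ j ∈ Finset.Ico k l, β j - f k (w l - w k)‖ ≤
      sewingConst (γ + γ) * (K * (1 + B) * G) * (h * (l - k)) ^ (γ + γ) := by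
  obtain rfl | hlt := hkl.eq_or_lt
  · simp [Real.zero_rpow (by linarith : γ + γ ≠ 0)]
  obtain ⟨l, rfl⟩ : ∃ n, l = n + 1 := ⟨l - 1, by omega⟩
  rw [hz.sub_eq hkl hl, add_sub_cancel_left, norm_sub_rev]
  exact_mod_cast hz.norm_riemannSum_sub_le hh hK hG hγ hB (Nat.le_of_lt_succ hlt) hl
    (hzB.mono (Nat.zero_le k) (by omega))

section EulerScheme

variable {U ι : Type*} [NormedAddCommGroup U] [NormedSpace ℝ U] [Fintype ι]

/-- One step, from the `k`-th grid point, of the reflected Euler scheme with mesh `h`. The pair `p`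
consists of the unreflected path and its regulator, so that their sum is the reflected path, and
`v` is the increment of the driver. -/
noncomputable def eulerStep (b : ℝ → EuclideanSpace ℝ ι → EuclideanSpace ℝ ι)
    (f : ℝ → EuclideanSpace ℝ ι → U →L[ℝ] EuclideanSpace ℝ ι) (h : ℝ) (k : ℕ)
    (p : EuclideanSpace ℝ ι × EuclideanSpace ℝ ι) (v : U) :
    EuclideanSpace ℝ ι × EuclideanSpace ℝ ι :=
  let z := p.1 + (∫ s in (h * k)..(h * (k + 1 : ℕ)), b s (p.1 + p.2)) + f (h * k) (p.1 + p.2) v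
  (z, WithLp.toLp 2 fun i => max (z i)⁻ (p.2 i))

/-- The reflected Euler scheme with mesh `h` started at `x₀` and driven by the grid values `w`, as
the sequence of pairs of the unreflected path and its regulator. -/
noncomputable def eulerState (b : ℝ → EuclideanSpace ℝ ι → EuclideanSpace ℝ ι)
    (f : ℝ → EuclideanSpace ℝ ι → U →L[ℝ] EuclideanSpace ℝ ι) (x₀ : EuclideanSpace ℝ ι) (h : ℝ)
    (w : ℕ → U) : ℕ → EuclideanSpace ℝ ι × EuclideanSpace ℝ ι
  | 0 => (x₀, 0)
  | k + 1 => eulerStep b f h k (eulerState b f x₀ h w k) (w (k + 1) - w k)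

variable {b : ℝ → EuclideanSpace ℝ ι → EuclideanSpace ℝ ι}
  {f : ℝ → EuclideanSpace ℝ ι → U →L[ℝ] EuclideanSpace ℝ ι} {x₀ : EuclideanSpace ℝ ι} {h : ℝ}

lemma isRegulator_eulerState (hx₀ : ∀ i, 0 ≤ x₀ i) (w : ℕ → U) (i : ι) :
    IsRegulator (fun k => (eulerState b f x₀ h w k).1 i) fun k => (eulerState b f x₀ h w k).2 i :=
  isRegulator_of_succ (negPart_eq_zero.2 (hx₀ i)).symm fun _ => rfl

variable {T γ : ℝ} {M K : ℝ≥0}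

lemma mul_natCast_mem_Icc {N k : ℕ} (hh : 0 ≤ h) (hN : h * N = T) (hk : k ≤ N) :
    h * k ∈ Icc 0 T :=
  ⟨by positivity, hN ▸ by gcongr⟩

lemma isGridSolution_eulerState (hc : CoefficientBounds T γ M K b f) (hx₀ : ∀ i, 0 ≤ x₀ i)
    (hh : 0 ≤ h) {N : ℕ} (hN : h * N = T) {G : ℝ} {w : ℕ → U} (hw : GridHolderOn G γ h w 0 N) :
    IsGridSolution M (K * (1 + √(Fintype.card ι))) G γ h N
      (fun k => (eulerState b f x₀ h w k).1)
      (fun k => f (h * k) ((eulerState b f x₀ h w k).1 + (eulerState b f x₀ h w k).2)) w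
      (fun k => ∫ s in (h * k)..(h * (k + 1 : ℕ)),
        b s ((eulerState b f x₀ h w k).1 + (eulerState b f x₀ h w k).2)) where
  step _ _ := rfl
  drift_le k hk := by
    refine (hc.norm_integral_drift_le (fun _ => _) (mul_natCast_mem_Icc hh hN hk.le)
      (mul_natCast_mem_Icc hh hN hk)).trans_eq ?_
    rw [← mul_sub, Nat.cast_succ, add_sub_cancel_left, mul_one, abs_of_nonneg hh]
  coeff_le k hk := hc.coeff_le _ (mul_natCast_mem_Icc hh hN hk.le) _
  coeff_sub_le k l hkl hl B hB := by
    have hkl' : (0 : ℝ) ≤ h * (l - k) := mul_nonneg hh (sub_nonneg.2 (Nat.cast_le.2 hkl))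
    have hx := norm_add_sub_add_le_of_isRegulator (isRegulator_eulerState hx₀ w) hkl
      fun j hj => hB j hj.1 hj.2
    refine (hc.coeff_sub_le _ (mul_natCast_mem_Icc hh hN (hkl.trans hl.le)) _
      (mul_natCast_mem_Icc hh hN hl.le) _ _).trans ?_
    rw [← mul_sub, abs_of_nonneg hkl', mul_assoc, mul_add (1 + _)]
    gcongr
    exact le_mul_of_one_le_left (by positivity) (le_add_of_nonneg_right (Real.sqrt_nonneg _))
  driver := hw

/-- The Young remainder of the unreflected Euler path between the `k`-th and the `l`-th grid
point. -/
noncomputable def eulerRemainder (b : ℝ → EuclideanSpace ℝ ι → EuclideanSpace ℝ ι)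
    (f : ℝ → EuclideanSpace ℝ ι → U →L[ℝ] EuclideanSpace ℝ ι) (x₀ : EuclideanSpace ℝ ι) (h : ℝ)
    (w : ℕ → U) (k l : ℕ) : EuclideanSpace ℝ ι :=
  let p := eulerState b f x₀ h w
  (p l).1 - (p k).1
    - (∑ j ∈ Finset.Ico k l, ∫ s in (h * j)..(h * (j + 1 : ℕ)), b s ((p j).1 + (p j).2))
    - f (h * k) ((p k).1 + (p k).2) (w l - w k)

theorem exists_eulerState_bounds (hc : CoefficientBounds T γ M K b f) (hx₀ : ∀ i, 0 ≤ x₀ i)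
    (hT : 0 ≤ T) (hγ : 1 / 2 < γ) (hγ1 : γ ≤ 1) {G : ℝ} (hG : 0 ≤ G) :
    ∃ (C : ℝ≥0) (A ε : ℝ), 0 < ε ∧ ∀ (h : ℝ) (N : ℕ) (w : ℕ → U), 0 < h → h ≤ ε → h * N = T →
      GridHolderOn G γ h w 0 N →
      GridHolderOn C γ h (fun k => (eulerState b f x₀ h w k).1) 0 N ∧
      ∀ k l, k ≤ l → l ≤ N →
        ‖eulerRemainder b f x₀ h w k l‖ ≤ A * (h * (l - k)) ^ (γ + γ) := by
  have hK : (0 : ℝ) ≤ K * (1 + √(Fintype.card ι)) := by positivity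
  obtain ⟨C, ε, hC, hε, hbound⟩ := exists_gridHolderOn_of_isGridSolution (U := U)
    (V := EuclideanSpace ℝ ι) M.coe_nonneg hK hG hγ hγ1 hT
  refine ⟨⟨C, hC⟩, sewingConst (γ + γ) * (K * (1 + √(Fintype.card ι)) * (1 + C) * G), ε, hε,
    fun h N w hh hhε hN hw => ?_⟩
  have hz := isGridSolution_eulerState hc hx₀ hh.le hN hw
  have hzC := hbound _ _ _ _ _ _ hz hh hhε hN.le
  exact ⟨hzC, fun k l hkl hl => hz.norm_sub_sub_sub_le hh.le hK hG hγ hC hzC hkl hl⟩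

lemma continuous_eulerStep (hc : CoefficientBounds T γ M K b f) (hγ : 0 < γ) {k : ℕ}
    (hk : h * k ∈ Icc 0 T) (hk' : h * (k + 1 : ℕ) ∈ Icc 0 T) :
    Continuous fun q : (EuclideanSpace ℝ ι × EuclideanSpace ℝ ι) × U =>
      eulerStep b f h k q.1 q.2 := by
  have hx : Continuous fun q : (EuclideanSpace ℝ ι × EuclideanSpace ℝ ι) × U => q.1.1 + q.1.2 := by
    fun_prop
  have hf : Continuous fun x => f (h * k) x :=
    (hc.continuous_coeff hγ).comp (.prodMk_right (⟨h * k, hk⟩ : Icc 0 T))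
  have hz := (continuous_fst.fst.add ((hc.continuous_integral_drift_const hk hk').comp hx)).add
    ((hf.comp hx).clm_apply continuous_snd)
  refine hz.prodMk ((PiLp.continuous_toLp 2 _).comp (continuous_pi fun i => ?_))
  refine .max (.sup (.neg ?_) continuous_const) (by fun_prop)
  exact (EuclideanSpace.proj (𝕜 := ℝ) i).continuous.comp hz

lemma aemeasurable_eulerState [MeasurableSpace U] [BorelSpace U] [SecondCountableTopology U]
    {Ω : Type*} [MeasurableSpace Ω] {P : Measure Ω} (hc : CoefficientBounds T γ M K b f)
    (hγ : 0 < γ) (hh : 0 ≤ h) {N : ℕ} (hN : h * N = T) {w : Ω → ℕ → U}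
    (hw : ∀ k, AEMeasurable (fun ω => w ω k) P) {k : ℕ} (hk : k ≤ N) :
    AEMeasurable (fun ω => eulerState b f x₀ h (w ω) k) P := by
  induction k with
  | zero => exact aemeasurable_const
  | succ k ih =>
    have hstep := (continuous_eulerStep hc hγ (mul_natCast_mem_Icc hh hN (Nat.le_of_succ_le hk))
      (mul_natCast_mem_Icc hh hN hk)).measurable
    have hcomp := hstep.comp_aemeasurable
      ((ih (Nat.le_of_succ_le hk)).prodMk ((hw (k + 1)).sub (hw k)))
    exact hcomp

end EulerScheme

lemma holderWith_skorokhodMap {ι : Type*} [Fintype ι] {T : ℝ} {C γ : ℝ≥0}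
    {z : C(Icc 0 T, EuclideanSpace ℝ ι)} (hz : HolderWith C γ z) :
    HolderWith ((1 + NNReal.sqrt (Fintype.card ι)) * C) γ (skorokhodMap z) := by
  refine holderWith_of_dist_le fun s t hst => ?_
  have hB : ∀ u ∈ Icc s t, ‖z u - z s‖ ≤ C * ((t : ℝ) - s) ^ (γ : ℝ) := fun u hu => by
    rw [← dist_eq_norm]
    refine hz.dist_le_of_le ?_
    rw [Subtype.dist_eq, Real.dist_eq, abs_of_nonneg (sub_nonneg.2 (Subtype.coe_le_coe.2 hu.1))]
    exact sub_le_sub_right (Subtype.coe_le_coe.2 hu.2) _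
  rw [dist_comm, dist_eq_norm, NNReal.coe_mul, NNReal.coe_add, NNReal.coe_one, Real.coe_sqrt,
    NNReal.coe_natCast, mul_assoc]
  exact norm_add_sub_add_le_of_isRegulator (isRegulator_orthantRegulator z) hst hB

section YoungRemainder

variable {U V α : Type*} [NormedAddCommGroup U] [NormedSpace ℝ U] [NormedAddCommGroup V]
  [NormedSpace ℝ V] {I : α → V} {F : α → U →L[ℝ] V} {g : α → U}

/-- The error of the one-point approximation of the increments of `I` as integrals of `F`
against `g`. -/
def youngRemainder (I : α → V) (F : α → U →L[ℝ] V) (g : α → U) (s t : α) : V :=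
  I t - I s - F s (g t - g s)

lemma youngRemainder_self (t : α) : youngRemainder I F g t t = 0 := by
  simp [youngRemainder]

lemma youngRemainder_sub_sub (s u t : α) :
    youngRemainder I F g s t - youngRemainder I F g s u - youngRemainder I F g u t =
      (F u - F s) (g t - g u) := by
  simp only [youngRemainder, sub_apply, map_sub]
  abel

lemma norm_youngRemainder_swap_le (s t : α) :
    ‖youngRemainder I F g t s‖ ≤ ‖youngRemainder I F g s t‖ + ‖F t - F s‖ * ‖g t - g s‖ := by
  have hswap : youngRemainder I F g t s =
      (F t - F s) (g t - g s) - youngRemainder I F g s t := by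
    simp only [youngRemainder, sub_apply, map_sub]
    abel
  rw [hswap, add_comm]
  exact (norm_sub_le _ _).trans (by gcongr; exact ContinuousLinearMap.le_opNorm _ _)

end YoungRemainder

lemma CoefficientBounds.norm_integral_drift_sub_sum_le {U V : Type*} [NormedAddCommGroup U]
    [NormedSpace ℝ U] [NormedAddCommGroup V] [NormedSpace ℝ V] {T γ : ℝ} {M K : ℝ≥0}
    {b : ℝ → V → V} {f : ℝ → V → U →L[ℝ] V} (hc : CoefficientBounds T γ M K b f) {x : ℝ → V}
    (hx : StronglyMeasurable x) {h B : ℝ} (hh : 0 ≤ h) {k l N : ℕ} (hN : h * N = T) (hkl : k ≤ l)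
    (hl : l ≤ N) (hB : ∀ j < l, ∀ u ∈ Icc (h * j) (h * (j + 1 : ℕ)), ‖x u - x (h * j)‖ ≤ B) :
    ‖(∫ u in (h * k)..(h * l), b u (x u)) -
        ∑ j ∈ Finset.Ico k l, ∫ u in (h * j)..(h * (j + 1 : ℕ)), b u (x (h * j))‖ ≤
      K * B * (h * (l - k)) := by
  have hgrid {j : ℕ} (hj : j ≤ l) : h * j ∈ Icc 0 T := mul_natCast_mem_Icc hh hN (hj.trans hl)
  rw [← intervalIntegral.sum_integral_adjacent_intervals_Ico (a := fun j : ℕ => h * j) hkl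
    fun j hj => hc.intervalIntegrable_drift hx (hgrid hj.2.le) (hgrid hj.2),
    ← Finset.sum_sub_distrib]
  refine (norm_sum_le_of_le (f := fun j => _) (n := fun _ => K * B * h) _
    fun j hj => ?_).trans_eq ?_
  · have hjl := (Finset.mem_Ico.1 hj).2
    have hle : h * j ≤ h * (j + 1 : ℕ) := by
      gcongr
      exact j.le_succ
    refine (hc.norm_integral_drift_sub_le hx stronglyMeasurable_const (hgrid hjl.le) (hgrid hjl)
      fun u hu => hB j hjl u (by rwa [uIcc_of_le hle] at hu)).trans_eq ?_
    rw [← mul_sub, Nat.cast_succ, add_sub_cancel_left, mul_one, abs_of_nonneg hh]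
  · rw [Finset.sum_const, Nat.card_Ico, nsmul_eq_mul, Nat.cast_sub hkl]
    ring

section Mesh

open Filter Topology

/-- The mesh of the partition of `[0, T]` into `n + 1` intervals of equal length. -/
noncomputable def mesh (T : ℝ) (n : ℕ) : ℝ :=
  T / (n + 1)

variable {T : ℝ} {n : ℕ}

lemma mesh_nonneg (hT : 0 ≤ T) : 0 ≤ mesh T n :=
  div_nonneg hT (by positivity)

lemma mesh_pos (hT : 0 < T) : 0 < mesh T n :=
  div_pos hT (by positivity)

lemma mesh_mul (T : ℝ) (n : ℕ) : mesh T n * (n + 1 : ℕ) = T := by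
  rw [mesh, Nat.cast_succ, div_mul_cancel₀ _ n.cast_add_one_ne_zero]

lemma tendsto_mesh (T : ℝ) : Tendsto (mesh T) atTop (𝓝 0) := by
  unfold mesh
  simpa [div_eq_mul_inv] using (tendsto_one_div_add_atTop_nhds_zero_nat (𝕜 := ℝ)).const_mul T

lemma mul_floor_div_le {h s : ℝ} (hh : 0 ≤ h) (hs : 0 ≤ s) : h * ⌊s / h⌋₊ ≤ s := by
  obtain rfl | hh := hh.eq_or_lt
  · simpa using hs
  · exact (le_div_iff₀' hh).1 (Nat.floor_le (div_nonneg hs hh.le))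

lemma mul_floor_div_mem_Icc (n : ℕ) (s : Icc 0 T) : mesh T n * ⌊s / mesh T n⌋₊ ∈ Icc 0 T := by
  have hh : 0 ≤ mesh T n := mesh_nonneg (s.2.1.trans s.2.2)
  exact ⟨by positivity, (mul_floor_div_le hh s.2.1).trans s.2.2⟩

/-- The last point up to `s` of the partition of `[0, T]` into `n + 1` intervals. -/
noncomputable def gridFloor (n : ℕ) (s : Icc 0 T) : Icc 0 T :=
  ⟨mesh T n * ⌊s / mesh T n⌋₊, mul_floor_div_mem_Icc n s⟩

lemma tendsto_gridFloor (hT : 0 < T) (s : Icc 0 T) :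
    Tendsto (fun n => gridFloor n s) atTop (𝓝 s) := by
  refine tendsto_subtype_rng.2 (tendsto_of_tendsto_of_tendsto_of_le_of_le
    (by simpa using (tendsto_mesh T).const_sub (s : ℝ)) tendsto_const_nhds (fun n => ?_)
    fun n => mul_floor_div_le (mesh_nonneg hT.le) s.2.1)
  have := (div_lt_iff₀' (mesh_pos hT)).1 (Nat.lt_floor_add_one ((s : ℝ) / mesh T n))
  change (s : ℝ) - mesh T n ≤ mesh T n * ⌊s / mesh T n⌋₊
  linarith

end Mesh

section EulerPath

open Filter Topology

variable {U ι : Type*} [NormedAddCommGroup U] [NormedSpace ℝ U] [Fintype ι]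

/-- What remains of an unreflected path `z` after removing the drift term along the reflected path
`skorokhodMap z`. For a solution of the reflected equation it is the initial value plus the integral
against the driver. -/
noncomputable def noiseIntegral {T : ℝ} (hT : 0 ≤ T)
    (b : ℝ → EuclideanSpace ℝ ι → EuclideanSpace ℝ ι) (z : C(Icc 0 T, EuclideanSpace ℝ ι))
    (t : Icc 0 T) : EuclideanSpace ℝ ι :=
  z t - driftIntegral hT b (skorokhodMap z) t

/-- The Young remainder of `noiseIntegral hT b z` as a candidate for the integral of the diffusion
coefficient, evaluated along the reflected path, against `g`. -/
noncomputable def noiseRemainder {T : ℝ} (hT : 0 ≤ T)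
    (b : ℝ → EuclideanSpace ℝ ι → EuclideanSpace ℝ ι)
    (f : ℝ → EuclideanSpace ℝ ι → U →L[ℝ] EuclideanSpace ℝ ι) (g : ℝ → U)
    (z : C(Icc 0 T, EuclideanSpace ℝ ι)) (s t : Icc 0 T) : EuclideanSpace ℝ ι :=
  youngRemainder (noiseIntegral hT b z) (fun s => f s (skorokhodMap z s)) (fun s => g s) s t

/-- The unreflected path of the Euler scheme on `n + 1` intervals, interpolated linearly. -/
noncomputable def eulerPath (b : ℝ → EuclideanSpace ℝ ι → EuclideanSpace ℝ ι)
    (f : ℝ → EuclideanSpace ℝ ι → U →L[ℝ] EuclideanSpace ℝ ι) (x₀ : EuclideanSpace ℝ ι) (T : ℝ)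
    (g : ℝ → U) (n : ℕ) : C(Icc 0 T, EuclideanSpace ℝ ι) :=
  polygonalMap T (mesh T n) (n + 1) fun k =>
    (eulerState b f x₀ (mesh T n) (fun j => g (mesh T n * j)) k).1

variable {b : ℝ → EuclideanSpace ℝ ι → EuclideanSpace ℝ ι}
  {f : ℝ → EuclideanSpace ℝ ι → U →L[ℝ] EuclideanSpace ℝ ι} {x₀ : EuclideanSpace ℝ ι}
  {T : ℝ} {γ G M K : ℝ≥0} {g : ℝ → U}

lemma CoefficientBounds.continuous_noiseRemainder (hc : CoefficientBounds T γ M K b f)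
    (hT : 0 ≤ T) (hγ : 0 < γ) (hg : ContinuousOn g (Icc 0 T)) :
    Continuous fun p : C(Icc 0 T, EuclideanSpace ℝ ι) × Icc 0 T × Icc 0 T =>
      noiseRemainder hT b f g p.1 p.2.1 p.2.2 := by
  have hnoise : Continuous fun p : C(Icc 0 T, EuclideanSpace ℝ ι) × Icc 0 T =>
      noiseIntegral hT b p.1 p.2 :=
    (continuous_fst.eval continuous_snd).sub
      ((hc.continuous_driftIntegral hT).comp (continuous_skorokhodMap.prodMap continuous_id))
  have hcoeff : Continuous fun p : C(Icc 0 T, EuclideanSpace ℝ ι) × Icc 0 T =>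
      f p.2 (skorokhodMap p.1 p.2) :=
    (hc.continuous_coeff (NNReal.coe_pos.2 hγ)).comp
      (continuous_snd.prodMk ((continuous_skorokhodMap.comp continuous_fst).eval continuous_snd))
  have hdriver : Continuous fun t : Icc 0 T => g t := hg.domRestrict
  exact ((hnoise.comp (continuous_fst.prodMk continuous_snd.snd)).sub
    (hnoise.comp (continuous_fst.prodMk continuous_snd.fst))).sub
    ((hcoeff.comp (continuous_fst.prodMk continuous_snd.fst)).clm_apply
      ((hdriver.comp continuous_snd.snd).sub (hdriver.comp continuous_snd.fst)))

lemma skorokhodMap_eulerPath_grid (hT : 0 < T) (hx₀ : ∀ i, 0 ≤ x₀ i) {n k : ℕ} (hk : k ≤ n + 1)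
    (hkT : mesh T n * k ∈ Icc 0 T) :
    skorokhodMap (eulerPath b f x₀ T g n) ⟨mesh T n * k, hkT⟩ =
      (eulerState b f x₀ (mesh T n) (fun j => g (mesh T n * j)) k).1 +
        (eulerState b f x₀ (mesh T n) (fun j => g (mesh T n * j)) k).2 :=
  congrArg₂ (· + ·) (polygonalMap_grid (mesh_pos hT).ne' _ hk hkT)
    (orthantRegulator_polygonalMap_grid (isRegulator_eulerState hx₀ _) (mesh_pos hT) hk hkT)

lemma eulerPath_left (hT : 0 < T) (n : ℕ) :
    eulerPath b f x₀ T g n ⟨0, left_mem_Icc.2 hT.le⟩ = x₀ := by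
  have h0 : mesh T n * (0 : ℕ) ∈ Icc 0 T := by simpa using hT.le
  rw [show (⟨0, left_mem_Icc.2 hT.le⟩ : Icc 0 T) = ⟨mesh T n * (0 : ℕ), h0⟩ by simp]
  exact polygonalMap_grid (mesh_pos hT).ne' _ (Nat.zero_le _) h0

lemma norm_IccExtend_sub_le_of_holderWith {E : Type*} [NormedAddCommGroup E] {C : ℝ≥0}
    {x : Icc 0 T → E} (hx : HolderWith C γ x) (hT : 0 ≤ T) (s t : ℝ) :
    ‖IccExtend hT x t - IccExtend hT x s‖ ≤ C * |t - s| ^ (γ : ℝ) := by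
  rw [← dist_eq_norm]
  refine hx.dist_le_of_le ?_
  simpa [Real.dist_eq] using (LipschitzWith.projIcc hT).dist_le_mul t s

lemma norm_noiseRemainder_eulerPath_sub_le (hc : CoefficientBounds T γ M K b f) (hT : 0 < T)
    (hx₀ : ∀ i, 0 ≤ x₀ i) {C : ℝ≥0} {n k l : ℕ}
    (hC : HolderWith C γ (skorokhodMap (eulerPath b f x₀ T g n))) (hkl : k ≤ l) (hl : l ≤ n + 1)
    (hk' : mesh T n * k ∈ Icc 0 T) (hl' : mesh T n * l ∈ Icc 0 T) :
    ‖noiseRemainder hT.le b f g (eulerPath b f x₀ T g n) ⟨mesh T n * k, hk'⟩ ⟨mesh T n * l, hl'⟩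
        - eulerRemainder b f x₀ (mesh T n) (fun j => g (mesh T n * j)) k l‖ ≤
      K * (C * mesh T n ^ (γ : ℝ)) * T := by
  have hh := mesh_nonneg hT.le (n := n)
  set p := eulerState b f x₀ (mesh T n) fun j => g (mesh T n * j) with hp
  set x := skorokhodMap (eulerPath b f x₀ T g n) with hx_def
  have hz {j : ℕ} (hj : j ≤ l) (hjT : mesh T n * j ∈ Icc 0 T) :
      eulerPath b f x₀ T g n ⟨mesh T n * j, hjT⟩ = (p j).1 :=
    polygonalMap_grid (mesh_pos hT).ne' _ (hj.trans hl) hjT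
  have hx {j : ℕ} (hj : j ≤ l) (hjT : mesh T n * j ∈ Icc 0 T) :
      x ⟨mesh T n * j, hjT⟩ = (p j).1 + (p j).2 :=
    skorokhodMap_eulerPath_grid hT hx₀ (hj.trans hl) hjT
  have hdrift := hc.norm_integral_drift_sub_sum_le (x.continuous.Icc_extend'.stronglyMeasurable)
    hh (mesh_mul T n) hkl hl (B := C * mesh T n ^ (γ : ℝ)) fun j _ u hu => by
      refine (norm_IccExtend_sub_le_of_holderWith hC hT.le _ _).trans ?_
      have := hu.2
      rw [Nat.cast_succ, mul_add, mul_one] at this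
      gcongr
      exact abs_le.2 ⟨by linarith [hu.1], by linarith⟩
  have hsum : ∑ j ∈ Finset.Ico k l, ∫ s in (mesh T n * j)..(mesh T n * (j + 1 : ℕ)),
      b s (IccExtend hT.le x (mesh T n * j)) = ∑ j ∈ Finset.Ico k l,
        ∫ s in (mesh T n * j)..(mesh T n * (j + 1 : ℕ)), b s ((p j).1 + (p j).2) := by
    refine Finset.sum_congr rfl fun j hj => ?_
    have hjl := (Finset.mem_Ico.1 hj).2.le
    have hjT := mul_natCast_mem_Icc hh (mesh_mul T n) (hjl.trans hl)
    rw [IccExtend_of_mem hT.le x hjT, hx hjl hjT]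
  rw [hsum, ← hc.driftIntegral_sub hT.le x hk' hl', norm_sub_rev] at hdrift
  simp only [noiseRemainder, youngRemainder, noiseIntegral, eulerRemainder, ← hx_def, ← hp,
    hz hkl, hz le_rfl, hx hkl]
  refine (congrArg norm ?_).trans_le (hdrift.trans ?_)
  · simp only [sub_sub_sub_cancel_right]
    abel
  · gcongr
    rw [mul_sub]
    linarith [hk'.1, hl'.2]

lemma gridHolderOn_of_holderOnWith {E : Type*} [NormedAddCommGroup E] {w : ℝ → E}
    (hw : HolderOnWith G γ w (Icc 0 T)) {h : ℝ} (hh : 0 ≤ h) {N : ℕ} (hN : h * N = T) :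
    GridHolderOn G γ h (fun k => w (h * k)) 0 N := fun i j _ hij hj => by
  rw [← dist_eq_norm]
  refine hw.dist_le_of_le (mul_natCast_mem_Icc hh hN hj)
    (mul_natCast_mem_Icc hh hN (hij.trans hj)) ?_
  rw [Real.dist_eq, ← mul_sub, abs_of_nonneg]
  exact mul_nonneg hh (sub_nonneg.2 (Nat.cast_le.2 hij))

theorem exists_eulerPath_bounds (hc : CoefficientBounds T γ M K b f) (hT : 0 < T)
    (hγ : 1 / 2 < (γ : ℝ)) (hγ1 : γ ≤ 1) (hx₀ : ∀ i, 0 ≤ x₀ i)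
    (hg : HolderOnWith G γ g (Icc 0 T)) :
    ∃ (C : ℝ≥0) (A : ℝ), ∀ᶠ n in atTop, HolderWith C γ (eulerPath b f x₀ T g n) ∧
      ∀ k l, k ≤ l → l ≤ n + 1 →
        ‖eulerRemainder b f x₀ (mesh T n) (fun j => g (mesh T n * j)) k l‖ ≤
          A * (mesh T n * (l - k)) ^ ((γ : ℝ) + γ) := by
  have hγ0 : 0 < γ := NNReal.coe_pos.1 (by linarith)
  obtain ⟨C, A, ε, hε, hbound⟩ :=
    exists_eulerState_bounds hc hx₀ hT.le hγ (NNReal.coe_le_one.2 hγ1) G.2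
  refine ⟨3 * C, A, ((tendsto_mesh T).eventually_le_const hε).mono fun n hn => ?_⟩
  obtain ⟨hC, hA⟩ := hbound (mesh T n) (n + 1) (fun j => g (mesh T n * j)) (mesh_pos hT) hn
    (mesh_mul T n) (gridHolderOn_of_holderOnWith hg (mesh_nonneg hT.le) (mesh_mul T n))
  exact ⟨hC.holderWith_polygonalMap (mesh_pos hT) (mesh_mul T n).ge hγ0 hγ1, hA⟩

theorem exists_isCompact_eventually_eulerPath_mem (hc : CoefficientBounds T γ M K b f)
    (hT : 0 < T) (hγ : 1 / 2 < (γ : ℝ)) (hγ1 : γ ≤ 1) (hx₀ : ∀ i, 0 ≤ x₀ i)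
    (hg : HolderOnWith G γ g (Icc 0 T)) :
    ∃ S, IsCompact S ∧ ∀ᶠ n in atTop, eulerPath b f x₀ T g n ∈ S := by
  obtain ⟨C, A, hCA⟩ := exists_eulerPath_bounds hc hT hγ hγ1 hx₀ hg
  exact ⟨_, isCompact_setOf_holderWith_apply_eq C (NNReal.coe_pos.1 (by linarith)) _ x₀,
    hCA.mono fun n hn => ⟨hn.1, eulerPath_left hT n⟩⟩

lemma norm_noiseRemainder_gridFloor_le (hc : CoefficientBounds T γ M K b f) (hT : 0 < T)
    (hx₀ : ∀ i, 0 ≤ x₀ i) {C : ℝ≥0} {A : ℝ} {n : ℕ}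
    (hC : HolderWith C γ (skorokhodMap (eulerPath b f x₀ T g n)))
    (hA : ∀ k l, k ≤ l → l ≤ n + 1 →
      ‖eulerRemainder b f x₀ (mesh T n) (fun j => g (mesh T n * j)) k l‖ ≤
        A * (mesh T n * (l - k)) ^ ((γ : ℝ) + γ)) {s t : Icc 0 T} (hst : s ≤ t) :
    ‖noiseRemainder hT.le b f g (eulerPath b f x₀ T g n) (gridFloor n s) (gridFloor n t)‖ ≤
      A * ((gridFloor n t : ℝ) - gridFloor n s) ^ ((γ : ℝ) + γ) +
        K * (C * mesh T n ^ (γ : ℝ)) * T := by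
  have hkl : ⌊s / mesh T n⌋₊ ≤ ⌊t / mesh T n⌋₊ :=
    Nat.floor_le_floor (div_le_div_of_nonneg_right (Subtype.coe_le_coe.2 hst) (mesh_nonneg hT.le))
  have hl : ⌊t / mesh T n⌋₊ ≤ n + 1 := Nat.floor_le_of_le (by
    rw [div_le_iff₀' (mesh_pos hT), mesh_mul]
    exact t.2.2)
  rw [add_comm]
  refine (norm_le_norm_sub_add _ _).trans (add_le_add
    (norm_noiseRemainder_eulerPath_sub_le hc hT hx₀ hC hkl hl _ _) ((hA _ _ hkl hl).trans_eq ?_))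
  simp only [gridFloor, mul_sub]

theorem exists_bounds_of_mapClusterPt_eulerPath (hc : CoefficientBounds T γ M K b f) (hT : 0 < T)
    (hγ : 1 / 2 < (γ : ℝ)) (hγ1 : γ ≤ 1) (hx₀ : ∀ i, 0 ≤ x₀ i)
    (hg : HolderOnWith G γ g (Icc 0 T)) {z : C(Icc 0 T, EuclideanSpace ℝ ι)}
    (hz : MapClusterPt z atTop (eulerPath b f x₀ T g)) :
    z ⟨0, left_mem_Icc.2 hT.le⟩ = x₀ ∧ (∃ C, HolderWith C γ z) ∧
      ∃ A : ℝ, ∀ s t : Icc 0 T, s ≤ t →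
        ‖noiseRemainder hT.le b f g z s t‖ ≤ A * ((t : ℝ) - s) ^ ((γ : ℝ) + γ) := by
  have hγ0 : 0 < γ := NNReal.coe_pos.1 (by linarith)
  have hγ0' : (0 : ℝ) < γ := hγ0
  obtain ⟨C, A, hCA⟩ := exists_eulerPath_bounds hc hT hγ hγ1 hx₀ hg
  obtain ⟨𝓤, h𝓤, hlim⟩ := mapClusterPt_iff_ultrafilter.1 hz
  refine ⟨?_, ⟨C, ?_⟩, A, fun s t hst => ?_⟩
  · refine tendsto_nhds_unique
      (((continuous_eval_const (⟨0, left_mem_Icc.2 hT.le⟩ : Icc 0 T)).tendsto z).comp hlim) ?_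
    exact tendsto_const_nhds.congr fun n => (eulerPath_left hT n).symm
  · exact (isClosed_setOf_continuousMap_holderWith C γ).mem_of_tendsto hlim
      ((hCA.filter_mono h𝓤).mono fun n hn => hn.1)
  · have hs := (tendsto_gridFloor hT s).mono_left h𝓤
    have ht := (tendsto_gridFloor hT t).mono_left h𝓤
    have hleft := ((hc.continuous_noiseRemainder hT.le hγ0 (hg.continuousOn hγ0)).tendsto
      (z, s, t)).comp (hlim.prodMk_nhds (hs.prodMk_nhds ht))
    have hdist : Tendsto (fun n => ((gridFloor n t : ℝ) - gridFloor n s) ^ ((γ : ℝ) + γ)) 𝓤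
        (𝓝 (((t : ℝ) - s) ^ ((γ : ℝ) + γ))) :=
      (((continuous_subtype_val.tendsto t).comp ht).sub
        ((continuous_subtype_val.tendsto s).comp hs)).rpow_const (Or.inr (by positivity))
    have hmesh : Tendsto (fun n => mesh T n ^ (γ : ℝ)) 𝓤 (𝓝 0) := by
      simpa [hγ0.ne'] using ((tendsto_mesh T).mono_left h𝓤).rpow_const (p := γ) (Or.inr hγ0'.le)
    have hright := (hdist.const_mul A).add (((hmesh.const_mul
      (((1 + NNReal.sqrt (Fintype.card ι)) * C : ℝ≥0) : ℝ)).const_mul (K : ℝ)).mul_const T)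
    simp only [mul_zero, zero_mul, add_zero] at hright
    exact le_of_tendsto_of_tendsto hleft.norm hright ((hCA.filter_mono h𝓤).mono fun n hn =>
      norm_noiseRemainder_gridFloor_le hc hT hx₀ (holderWith_skorokhodMap hn.1) hn.2 hst)

lemma aemeasurable_eulerPath [MeasurableSpace U] [BorelSpace U] [SecondCountableTopology U]
    [MeasurableSpace C(Icc 0 T, EuclideanSpace ℝ ι)] [BorelSpace C(Icc 0 T, EuclideanSpace ℝ ι)]
    {Ω : Type*} [MeasurableSpace Ω] {P : Measure Ω} (hc : CoefficientBounds T γ M K b f)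
    (hT : 0 ≤ T) (hγ : 0 < γ) {w : Ω → ℝ → U} (hw : ∀ t, AEMeasurable (fun ω => w ω t) P) (n : ℕ) :
    AEMeasurable (fun ω => eulerPath b f x₀ T (w ω) n) P :=
  aemeasurable_polygonalMap fun _ hk =>
    (aemeasurable_eulerState hc (NNReal.coe_pos.2 hγ) (mesh_nonneg hT) (mesh_mul T n)
      (fun _ => hw _) hk).fst

end EulerPath

section ReflectedEquation

open Filter Topology
open scoped Matrix.Norms.Frobenius

variable {d m : ℕ} {T ν : ℝ} {γ : ℝ≥0}

theorem isYoungIntegral_of_norm_youngRemainder_le {κ C D : ℝ≥0} (hκ : 0 < κ) (hγ : 0 < γ)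
    (hκγ : 1 < κ + γ) {f : ℝ → Matrix (Fin d) (Fin m) ℝ} {g : ℝ → EuclideanSpace ℝ (Fin m)}
    {I : ℝ → EuclideanSpace ℝ (Fin d)} {A : ℝ} (hf : HolderOnWith C κ f (Icc 0 T))
    (hg : HolderOnWith D γ g (Icc 0 T)) (hI : ContinuousOn I (Icc 0 T))
    (hA : ∀ s ∈ Icc 0 T, ∀ t ∈ Icc 0 T, s ≤ t →
      ‖youngRemainder I (fun s => matrixCLM (f s)) g s t‖ ≤ A * (t - s) ^ ((κ : ℝ) + γ)) :
    IsYoungIntegral T f g fun s t => I t - I s := by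
  have hfst : MapsTo Prod.fst (Icc 0 T ×ˢ Icc 0 T) (Icc 0 T) := fun p hp => hp.1
  have hsnd : MapsTo Prod.snd (Icc 0 T ×ˢ Icc 0 T) (Icc 0 T) := fun p hp => hp.2
  have hF : ContinuousOn (fun s => matrixCLM (f s)) (Icc 0 T) :=
    continuous_matrixCLM.comp_continuousOn (hf.continuousOn hκ)
  have hbound {s t : ℝ} (hs : s ∈ Icc 0 T) (ht : t ∈ Icc 0 T) (hst : s ≤ t) :
      ‖youngRemainder I (fun s => matrixCLM (f s)) g s t‖ + ‖matrixCLM (f t) - matrixCLM (f s)‖ *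
        ‖g t - g s‖ ≤ (A + C * D) * (t - s) ^ ((κ : ℝ) + γ) := by
    have hst' : dist t s = t - s := by rw [Real.dist_eq, abs_of_nonneg (sub_nonneg.2 hst)]
    have hpow : (C * (t - s) ^ (κ : ℝ)) * (D * (t - s) ^ (γ : ℝ)) =
        C * D * (t - s) ^ ((κ : ℝ) + γ) := by
      rw [Real.rpow_add_of_nonneg (sub_nonneg.2 hst) κ.coe_nonneg γ.coe_nonneg]
      ring
    rw [add_mul, ← hpow, ← hst', ← matrixCLM_sub, ← dist_eq_norm (g t)]
    refine add_le_add (hst' ▸ hA s hs t ht hst) (mul_le_mul ((norm_matrixCLM_le _).trans ?_)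
      (hg.dist_le ht hs) dist_nonneg (by positivity))
    exact (dist_eq_norm (f t) (f s)).symm.trans_le (hf.dist_le ht hs)
  refine ⟨⟨κ, γ, C, D, hκ, hγ, hκγ, hf, hg⟩, youngRemainder I (fun s => matrixCLM (f s)) g,
    ⟨?_, fun t _ => youngRemainder_self t, ⟨A + C * D, κ + γ, by exact_mod_cast hκγ,
      fun s hs t ht => ?_⟩, fun s _ u _ t _ => ?_⟩, fun s _ t _ => (add_sub_cancel _ _).symm⟩
  · exact ((hI.comp continuousOn_snd hsnd).sub (hI.comp continuousOn_fst hfst)).sub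
      ((hF.comp continuousOn_fst hfst).clm_apply
        (((hg.continuousOn hγ).comp continuousOn_snd hsnd).sub
          ((hg.continuousOn hγ).comp continuousOn_fst hfst)))
  · obtain hst | hts := le_total s t
    · rw [abs_of_nonneg (sub_nonneg.2 hst)]
      exact (le_add_of_nonneg_right (by positivity)).trans (hbound hs ht hst)
    · rw [abs_sub_comm, abs_of_nonneg (sub_nonneg.2 hts)]
      exact (norm_youngRemainder_swap_le t s).trans (hbound ht hs hts)
  · rw [youngRemainder_sub_sub, ← matrixCLM_sub]
    rfl

lemma DiffusionHypothesis.exists_holderOnWith_comp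
    {σ : ℝ → EuclideanSpace ℝ (Fin d) → Matrix (Fin d) (Fin m) ℝ} (hσ : DiffusionHypothesis T ν σ)
    (hγ : 0 < γ) (hγν : γ ≤ ν) {C : ℝ≥0} {x : ℝ → EuclideanSpace ℝ (Fin d)}
    (hx : HolderOnWith C γ x (Icc 0 T)) :
    ∃ D, HolderOnWith D γ (fun s => σ s (x s)) (Icc 0 T) := by
  obtain ⟨K, hK⟩ := hσ.exists_norm_sub_le (NNReal.coe_pos.2 hγ) hγν
  refine ⟨K * (1 + C), HolderWith.restrict_iff.1 (holderWith_of_dist_le fun s t hst => ?_)⟩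
  have hst' : dist (t : ℝ) s = t - s := by
    rw [Real.dist_eq, abs_of_nonneg (sub_nonneg.2 (Subtype.coe_le_coe.2 hst))]
  rw [dist_comm, dist_eq_norm]
  refine (hK s s.2 t t.2 _ _).trans ?_
  rw [← Real.dist_eq, ← dist_eq_norm, NNReal.coe_mul, NNReal.coe_add, NNReal.coe_one, mul_assoc,
    add_mul, one_mul, ← hst']
  gcongr
  exact hx.dist_le t.2 s.2

theorem isReflectedSolution_skorokhodMap
    {b : ℝ → EuclideanSpace ℝ (Fin d) → EuclideanSpace ℝ (Fin d)}
    {σ : ℝ → EuclideanSpace ℝ (Fin d) → Matrix (Fin d) (Fin m) ℝ} {M K C G : ℝ≥0}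
    (hc : CoefficientBounds T γ M K b fun t x => matrixCLM (σ t x))
    (hσ : DiffusionHypothesis T ν σ) (hT : 0 ≤ T) (hγ : 1 / 2 < (γ : ℝ)) (hγν : γ ≤ ν)
    {x₀ : EuclideanSpace ℝ (Fin d)} (hx₀ : ∀ i, 0 ≤ x₀ i) {g : ℝ → EuclideanSpace ℝ (Fin m)}
    (hg : HolderOnWith G γ g (Icc 0 T)) {z : C(Icc 0 T, EuclideanSpace ℝ (Fin d))}
    (hz0 : z ⟨0, left_mem_Icc.2 hT⟩ = x₀) (hz : HolderWith C γ z) {A : ℝ}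
    (hA : ∀ s t : Icc 0 T, s ≤ t →
      ‖noiseRemainder hT b (fun t x => matrixCLM (σ t x)) g z s t‖ ≤
        A * ((t : ℝ) - s) ^ ((γ : ℝ) + γ)) :
    IsReflectedSolution T b σ x₀ g (IccExtend hT (skorokhodMap z)) := by
  have hγ0 : 0 < γ := NNReal.coe_pos.1 (by linarith)
  have hγγ : 1 < γ + γ := by
    rw [← NNReal.coe_lt_coe]
    push_cast
    linarith
  obtain ⟨D, hD⟩ := hσ.exists_holderOnWith_comp (x := IccExtend hT (skorokhodMap z)) hγ0 hγν
    (HolderWith.restrict_iff.1 (by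
      rw [show (Icc 0 T).domRestrict (IccExtend hT (skorokhodMap z)) = skorokhodMap z from
        funext fun t => IccExtend_val hT _ t]
      exact holderWith_skorokhodMap hz))
  have hI : Continuous (noiseIntegral hT b z) :=
    z.continuous.sub ((hc.continuous_driftIntegral hT).comp (.prodMk_right _))
  refine ⟨hc.intervalIntegrable_drift (skorokhodMap z).continuous.Icc_extend'.stronglyMeasurable
      (left_mem_Icc.2 hT) (right_mem_Icc.2 hT),
    _, IccExtend hT z, IccExtend hT (orthantRegulator z),
    isYoungIntegral_of_norm_youngRemainder_le (A := A) hγ0 hγ0 hγγ hD hg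
      (hI.Icc_extend' (h := hT)).continuousOn fun s hs t ht hst => ?_,
    fun t ht => ?_, fun t ht i => ?_,
    isSkorokhodSolution_skorokhodMap hT z fun i => by rw [hz0]; exact hx₀ i⟩
  · refine le_of_eq_of_le (congrArg norm ?_) (hA ⟨s, hs⟩ ⟨t, ht⟩ hst)
    simp only [noiseRemainder, youngRemainder, IccExtend_of_mem hT _ hs, IccExtend_of_mem hT _ ht]
  · rw [IccExtend_of_mem hT _ ht, IccExtend_of_mem hT _ ht,
      IccExtend_of_mem hT _ (left_mem_Icc.2 hT)]
    simp only [noiseIntegral, hz0, driftIntegral, intervalIntegral.integral_same]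
    abel
  · exact isGreatest_image_Icc_of_isRegulator hT (isRegulator_orthantRegulator z i) ht

end ReflectedEquation

theorem mainTheorem1_general {Ω : Type*} [MeasurableSpace Ω] (P : Measure Ω)
    (d m : ℕ) (T : ℝ) (hT : 0 < T) (γ : ℝ≥0) (hγ : 1 / 2 < (γ : ℝ)) (hγ1 : γ ≤ 1)
    (g : Ω → ℝ → EuclideanSpace ℝ (Fin m)) (hgm : ∀ t, AEMeasurable (fun ω => g ω t) P)
    (hg : ∀ᵐ ω ∂P, ∃ C, HolderOnWith C γ (g ω) (Icc 0 T))
    (ν : ℝ) (hν : γ ≤ ν)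
    (σ : ℝ → EuclideanSpace ℝ (Fin d) → Matrix (Fin d) (Fin m) ℝ)
    (hσ : DiffusionHypothesis T ν σ)
    (b : ℝ → EuclideanSpace ℝ (Fin d) → EuclideanSpace ℝ (Fin d))
    (hb : DriftHypothesis T b)
    (x₀ : EuclideanSpace ℝ (Fin d)) (hx₀ : ∀ i, 0 ≤ x₀ i)
    (lam₀ : ℝ≥0) (hlamγ : lam₀ < γ) :
    ∃ X : Ω →ₘ[P] HolderSpace lam₀ T (EuclideanSpace ℝ (Fin d)),
      ∀ᵐ ω ∂P, IsReflectedSolution T b σ x₀ (g ω) (IccExtend hT.le (X ω)) := by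
  borelize C(Icc 0 T, EuclideanSpace ℝ (Fin d))
  have hγ0 : 0 < γ := zero_le.trans_lt hlamγ
  obtain ⟨M, K, hc⟩ := exists_coefficientBounds (NNReal.coe_pos.2 hγ0) hν hb hσ
  obtain ⟨Z, hZm, hZ⟩ := exists_aemeasurable_mapClusterPt
    (fun n => aemeasurable_eulerPath (x₀ := x₀) hc hT.le hγ0 hgm n)
    (hg.mono fun ω ⟨G, hG⟩ => exists_isCompact_eventually_eulerPath_mem hc hT hγ hγ1 hx₀ hG)
  have hsol : ∀ᵐ ω ∂P, MemHolder γ (skorokhodMap (Z ω)) ∧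
      IsReflectedSolution T b σ x₀ (g ω) (IccExtend hT.le (skorokhodMap (Z ω))) := by
    filter_upwards [hg, hZ] with ω ⟨G, hG⟩ hZω
    obtain ⟨hz0, ⟨C, hC⟩, A, hA⟩ :=
      exists_bounds_of_mapClusterPt_eulerPath hc hT hγ hγ1 hx₀ hG hZω
    exact ⟨(holderWith_skorokhodMap hC).memHolder,
      isReflectedSolution_skorokhodMap hc hσ hT.le hγ hν hx₀ hG hz0 hC hA⟩
  have hXm := HolderSpace.aestronglyMeasurable_ofContinuousMap_comp
    (continuous_skorokhodMap.measurable.comp_aemeasurable hZm).aestronglyMeasurable hlamγ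
    (hsol.mono fun _ h => h.1)
  refine ⟨AEEqFun.mk _ hXm, ?_⟩
  filter_upwards [AEEqFun.coeFn_mk _ hXm, hsol] with ω hω ⟨hmem, hsolω⟩
  rw [hω]
  convert hsolω using 2
  exact congrArg DFunLike.coe (HolderSpace.ofContinuousMap_val (hmem.of_le hlamγ.le))

theorem mainTheorem1 {Ω : Type*} [MeasurableSpace Ω] (P : Measure Ω) [IsProbabilityMeasure P]
    (d m : ℕ) (T : ℝ) (hT : 0 < T) (H : ℝ) (hH : 1 / 2 < H) (hH1 : H < 1)
    (W : Fin m → ℝ≥0 → Ω → ℝ)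
    (hW : ∀ j, IsFractionalBrownianMotion H (W j) P)
    (hWindep : iIndepFun (fun j ω t => W j t ω) P)
    (ν : ℝ) (hν : H ≤ ν)
    (σ : ℝ → EuclideanSpace ℝ (Fin d) → Matrix (Fin d) (Fin m) ℝ)
    (hσ : DiffusionHypothesis T ν σ)
    (b : ℝ → EuclideanSpace ℝ (Fin d) → EuclideanSpace ℝ (Fin d))
    (hb : DriftHypothesis T b)
    (x₀ : EuclideanSpace ℝ (Fin d)) (hx₀ : ∀ i, 0 < x₀ i)
    (lam₀ : ℝ≥0) (hlam : 1 / 2 < (lam₀ : ℝ)) (hlamH : (lam₀ : ℝ) < H) :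
    ∃ X : Ω →ₘ[P] HolderSpace lam₀ T (EuclideanSpace ℝ (Fin d)),
      ∀ᵐ ω ∂P, IsReflectedSolution T b σ x₀ (drivingPath W ω) (IccExtend hT.le (X ω)) := by
  obtain ⟨γ, hlamγ, hγH⟩ := exists_between (Real.lt_toNNReal_iff_coe_lt.2 hlamH)
  rw [Real.lt_toNNReal_iff_coe_lt] at hγH
  have hγ0 : 0 < γ := zero_le.trans_lt hlamγ
  exact mainTheorem1_general P d m T hT γ (hlam.trans (NNReal.coe_lt_coe.2 hlamγ))
    (NNReal.coe_le_one.1 (hγH.trans hH1).le) (drivingPath W) (aemeasurable_drivingPath hW)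
    (ae_exists_holderOnWith_drivingPath hW hγ0 hγH hT) ν (hγH.le.trans hν) σ hσ b hb x₀
    (fun i => (hx₀ i).le) lam₀ hlamγ
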